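/- Notation. Let $\mathbb T^3=\mathbb R^3/\mathbb Z^3\ni x=(x',z)$, and for $f:\mathbb T^3\to\mathbb R^2$ let $\hat f_k=\int_{\mathbb T^3}e^{-ik\cdot x}f(x)\,dx$, $k\in 2\pi\mathbb Z^3$; let $A=|\nabla|$ be the Fourier multiplier with symbol $|k|$. For $\sigma>0$ and $r>0$ let $\mathcal G^{\sigma,1}_r$ be the space of $f\in L^2(\mathbb T^3;\mathbb R^2)$ with $$\|f\|_{\mathcal G^{\sigma,1}_r}=\Big(\sum_{k}\big(1+e^{2r|k|}|k|^{2\sigma}\big)|\hat f_k|^2\Big)^{1/2}<\infty .$$ Let $H$ be the space of $f\in L^2(\mathbb T^3;\mathbb R^2)$ that have zero mean, are even in $z$, and satisfy $\nabla_h\cdot\bar f=0$, where $\bar f(x')=\int_0^1 f(x',z)\,dz$ and $\nabla_h=(\partial_{x_1},\partial_{x_2})$. Put $w(U)(x',z)=-\int_0^z\nabla_h\cdot U(x',\zeta)\,d\zeta$, $Q(U,V)=U\cdot\nabla_hV+w(U)\partial_zV$, and let $\mathcal P f=(f-\bar f)+\big(\bar f-\nabla_h\Delta_h^{-1}\nabla_h\cdot\bar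 f\big)$ be the hydrostatic Leray projection. Let $\Omega=\{\omega\in C([0,\infty);\mathbb R):\omega(0)=0\}$, $W_t(\omega)=\omega(t)$, and, for $\nu>0$ and $T>0$, let $\Gamma^{-1}(t)=e^{\nu W_t(\omega)}$ and $M_\omega=\sup_{t\in[0,T]}\Gamma^{-1}(t)$. Proposition. Let $\sigma>\frac52$ and $T>0$. There is a function $\mathcal T(\cdot,\cdot,\cdot)$, depending only on $\sigma$ and $T$, such that the following holds for all $\nu>0$, $\phi_0>0$, $U_0\in H\cap\mathcal G^{\sigma,1}_{\phi_0}$ and $\omega\in\Omega$. Put $\mathcal T=\mathcal T\big(\|U_0\|_{\mathcal G^{\sigma,1}_{\phi_0}},\phi_0,M_\omega\big)$. Then $0<\mathcal T\le T$, and there is $\phi\in C^1(\mathbb R)$ (which may depend on $\omega$) with $\phi(0)=\phi_0$ and with $\phi>0$, $\phi'\le0$ on $[0,T]$, such that the random PDE $$\partial_tU+\Gamma^{-1}\mathcal P\,Q(U,U)=-\tfrac12\nu^2U,\qquad U(0)=U_0,$$ has exactly one solution on $[0,\mathcal T]$ with $U(t)\in H$ for all $t\in[0,\mathcal T]$ and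 $$U\in C\big([0,\mathcal T];\mathcal G^{\sigma,1}_{\phi}\big)\cap L^2\big(0,\mathcal T;\mathcal G^{\sigma+\frac12,1}_{\phi}\big).$$ Here $U\in C([0,\mathcal T];\mathcal G^{\sigma,1}_\phi)$ means that $U(t)\in\mathcal G^{\sigma,1}_{\phi(t)}$ for all $t\in[0,\mathcal T]$ and that $t\mapsto U(t)\in L^2$ and $t\mapsto e^{\phi(t)A}U(t)\in\dot H^\sigma$ are continuous; $U\in L^2(0,\mathcal T;\mathcal G^{\sigma+\frac12,1}_\phi)$ means that $U$ is measurable in time and $\int_0^{\mathcal T}\|U(t)\|^2_{\mathcal G^{\sigma+1/2,1}_{\phi(t)}}\,dt<\infty$; such $U(t)$ are identified with their continuously differentiable representatives, and the equation is understood in the sense that each Fourier coefficient of $U$ is differentiable in time on $[0,\mathcal T]$ (one-sidedly at the end points) and satisfies the corresponding equation. -/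

import Mathlib

open MeasureTheory Set Filter Topology
open scoped ENNReal NNReal

noncomputable section

namespace DampedPE

/-- The three-dimensional torus `ℝ³ / ℤ³`; coordinates `0, 1` are horizontal, `2` is vertical. -/
abbrev Torus3 : Type := UnitAddTorus (Fin 3)

/-- A horizontal velocity field (or any `ℝ²`-valued field) on the torus. -/
abbrev Field : Type := Torus3 → Fin 2 → ℝ

/-- The Haar (Lebesgue) measure on the torus, of total mass one. -/
def torusMeasure : Measure Torus3 :=
  Measure.pi fun _ : Fin 3 => (AddCircle.haarAddCircle : Measure UnitAddCircle)

/-! ### Fourier coefficients, Gevrey norms -/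

/-- The `i`-th component of the Fourier coefficient of `f` at the frequency `k = 2πn`:
`∫ e^{-2πi n·x} f_i(x) dx`. -/
def coef (f : Field) (n : Fin 3 → ℤ) (i : Fin 2) : ℂ :=
  UnitAddTorus.mFourierCoeff (fun x => ((f x i : ℝ) : ℂ)) n

/-- The Euclidean length `|k|` of `k = 2πn`. -/
def freq (n : Fin 3 → ℤ) : ℝ := 2 * Real.pi * Real.sqrt (∑ j, (n j : ℝ) ^ 2)

/-- The Gevrey norm of order `s = 1`, radius `r` and index `σ`,
`(∑_k (1 + e^{2r|k|} |k|^{2σ}) |f̂_k|²)^{1/2}`, as an extended real number. -/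
def gevreyENorm (σ r : ℝ) (f : Field) : ℝ≥0∞ :=
  (∑' n : Fin 3 → ℤ, ENNReal.ofReal
    ((1 + Real.exp (2 * r * freq n) * freq n ^ (2 * σ)) * ∑ i, ‖coef f n i‖ ^ 2)) ^ (1 / 2 : ℝ)

/-- Membership in the analytic class `𝒢_r^{σ,1}`: square integrable with finite Gevrey norm. -/
def MemGevrey (σ r : ℝ) (f : Field) : Prop :=
  MemLp f 2 torusMeasure ∧ gevreyENorm σ r f < ∞

/-- The Gevrey norm as a real number. -/
def gevreyNorm (σ r : ℝ) (f : Field) : ℝ := (gevreyENorm σ r f).toReal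

/-- The square of the distance `‖e^{rA} f - e^{r'A} g‖_{Ḣ^σ}² + ‖f - g‖_{L²}²` by which elements
of the Gevrey classes of two radii `r`, `r'` are compared. For `r = r'` it is the square of the
Gevrey norm of `f - g`. -/
def gevreyDistSq (σ r r' : ℝ) (f g : Field) : ℝ≥0∞ :=
  ∑' n : Fin 3 → ℤ, ENNReal.ofReal
    (freq n ^ (2 * σ) * ∑ i, ‖(Real.exp (r * freq n) : ℂ) * coef f n i
        - (Real.exp (r' * freq n) : ℂ) * coef g n i‖ ^ 2
      + ∑ i, ‖coef f n i - coef g n i‖ ^ 2)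

/-- `U ∈ C([0,τ]; 𝒢_φ^{σ,1})` for a time dependent radius `φ`: each `U(t)` lies in
`𝒢_{φ(t)}^{σ,1}`, and `t ↦ U(t)` is continuous into `L²` and `t ↦ e^{φ(t)A} U(t)` is
continuous into `Ḣ^σ`. -/
def MemCGevrey (σ : ℝ) (φ : ℝ → ℝ) (τ : ℝ) (U : ℝ → Field) : Prop :=
  (∀ t ∈ Icc (0 : ℝ) τ, MemGevrey σ (φ t) (U t)) ∧
  ∀ t₀ ∈ Icc (0 : ℝ) τ,
    Tendsto (fun t => gevreyDistSq σ (φ t) (φ t₀) (U t) (U t₀)) (𝓝[Icc (0 : ℝ) τ] t₀) (𝓝 0)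

/-- `U ∈ L²(0,τ; 𝒢_φ^{σ,1})`: (weakly) measurable in time, with square integrable norm. -/
def MemL2Gevrey (σ : ℝ) (φ : ℝ → ℝ) (τ : ℝ) (U : ℝ → Field) : Prop :=
  (∀ n i, AEStronglyMeasurable (fun t => coef (U t) n i) (volume.restrict (Icc (0 : ℝ) τ))) ∧
  (∀ᵐ t ∂(volume.restrict (Icc (0 : ℝ) τ)), MemGevrey σ (φ t) (U t)) ∧
  ∫⁻ t in Icc (0 : ℝ) τ, gevreyENorm σ (φ t) (U t) ^ 2 < ∞

/-! ### The space of admissible velocity fields -/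

/-- The reflection `(x', z) ↦ (x', -z)`. -/
def reflectZ (x : Torus3) : Torus3 := Function.update x 2 (-x 2)

/-- The space `H` together with the symmetry imposed by the boundary conditions:
square integrable, mean zero, with horizontally divergence-free barotropic part, and even in `z`.
The Fourier coefficients of the barotropic part `∫₀¹ f(x', z) dz` are those of `f` at the
frequencies with vanishing vertical component, so the third condition says
`∇_h · f̄ = 0` in the sense of distributions. -/
structure MemH (f : Field) : Prop where
  memLp : MemLp f 2 torusMeasure
  mean_zero : ∀ i, ∫ x, f x i ∂torusMeasure = 0
  barotropic_div_free : ∀ n : Fin 3 → ℤ, n 2 = 0 →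
    (n 0 : ℂ) * coef f n 0 + (n 1 : ℂ) * coef f n 1 = 0
  even_z : ∀ᵐ x ∂torusMeasure, f (reflectZ x) = f x

/-- `f` is continuously differentiable on the torus (its periodic lift to `ℝ³` is). -/
def IsC1 (f : Field) : Prop :=
  ContDiff ℝ 1 (fun y : Fin 3 → ℝ => f (fun j => (y j : UnitAddCircle)))

/-! ### The nonlinearity -/

/-- The partial derivative `∂_j` of a scalar function on the torus. -/
def pd (j : Fin 3) (g : Torus3 → ℝ) (x : Torus3) : ℝ :=
  deriv (fun h : ℝ => g (x + Pi.single j (h : UnitAddCircle))) 0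

/-- The horizontal divergence `∇_h · V`. -/
def divh (V : Field) (x : Torus3) : ℝ :=
  pd 0 (fun y => V y 0) x + pd 1 (fun y => V y 1) x

/-- The vertical velocity `w(V)(x', z) = -∫₀^z ∇_h · V(x', ζ) dζ`, with `z` represented in
`[0,1)`; for `V` in `H` the integral over a full period vanishes, so that the choice of the
representative plays no role. -/
def vertVel (V : Field) (x : Torus3) : ℝ :=
  - ∫ ζ in (0 : ℝ)..(AddCircle.equivIco 1 0 (x 2) : ℝ),
      divh V (Function.update x 2 (ζ : UnitAddCircle))

/-- The bilinear term `Q(U,V) = U · ∇_h V + w(U) ∂_z V`. -/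
def Q (U V : Field) : Field := fun x i =>
  U x 0 * pd 0 (fun y => V y i) x + U x 1 * pd 1 (fun y => V y i) x
    + vertVel U x * pd 2 (fun y => V y i) x

/-- The Fourier symbol of the hydrostatic Leray projection `𝒫 f = f̃ + 𝒫_h f̄`,
`𝒫_h f̄ = f̄ - ∇_h Δ_h⁻¹ ∇_h · f̄`: it is the identity at the frequencies with nonzero vertical
component, and `a ↦ a - k' (k' · a) / |k'|²` at those with zero vertical component (the identity
again if `k' = 0`, in agreement with `0 / 0 = 0`). -/
def leraySymbol (n : Fin 3 → ℤ) (a : Fin 2 → ℂ) : Fin 2 → ℂ :=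
  if n 2 = 0 then
    ![a 0 - (n 0 : ℂ) * ((n 0 : ℂ) * a 0 + (n 1 : ℂ) * a 1) / ((n 0 : ℂ) ^ 2 + (n 1 : ℂ) ^ 2),
      a 1 - (n 1 : ℂ) * ((n 0 : ℂ) * a 0 + (n 1 : ℂ) * a 1) / ((n 0 : ℂ) ^ 2 + (n 1 : ℂ) ^ 2)]
  else a

/-! ### The noise and the equation -/

/-- The canonical Wiener space: continuous paths `[0,∞) → ℝ` that start at `0`. -/
abbrev WienerSpace : Type := {ω : C(ℝ≥0, ℝ) // ω 0 = 0}

/-- The Brownian motion `W_t(ω) = ω(t)`. -/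
def W (ω : WienerSpace) (t : ℝ) : ℝ := ω.1 t.toNNReal

/-- `Γ⁻¹(t) = e^{ν W_t}`. -/
def gammaInv (ν : ℝ) (ω : WienerSpace) (t : ℝ) : ℝ := Real.exp (ν * W ω t)

/-- `M_ω = sup_{t ∈ [0,T]} Γ⁻¹(t)`. -/
def supGammaInv (ν T : ℝ) (ω : WienerSpace) : ℝ := sSup (gammaInv ν ω '' Icc (0 : ℝ) T)

/-- `U` solves `∂_t U + Γ⁻¹ 𝒫 Q(U,U) = - ½ ν² U` on `[0,τ]` with `U(0) = U₀`. Each `U(t)` lies in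
`H` and is a `C¹` field, so that `Q(U,U)` is a genuine function; the equation is tested against
every exponential `e^{ik·x}`, at every time (one-sided derivatives at the end points). -/
structure SolvesDampedPE (ν : ℝ) (ω : WienerSpace) (U₀ : Field) (τ : ℝ) (U : ℝ → Field) :
    Prop where
  memH : ∀ t ∈ Icc (0 : ℝ) τ, MemH (U t)
  isC1 : ∀ t ∈ Icc (0 : ℝ) τ, IsC1 (U t)
  init : U 0 =ᵐ[torusMeasure] U₀
  equation : ∀ t ∈ Icc (0 : ℝ) τ, ∀ (n : Fin 3 → ℤ) (i : Fin 2),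
    HasDerivWithinAt (fun r => coef (U r) n i)
      (-(gammaInv ν ω t : ℂ) * leraySymbol n (coef (Q (U t) (U t)) n) i
        - (1 / 2 : ℂ) * (ν : ℂ) ^ 2 * coef (U t) n i)
      (Icc (0 : ℝ) τ) t

/-- `U` is a solution in the class `C([0,τ]; 𝒢_φ^{σ,1}) ∩ L²(0,τ; 𝒢_φ^{σ+1/2,1})`. -/
structure IsGevreySolution (σ ν : ℝ) (ω : WienerSpace) (φ : ℝ → ℝ) (U₀ : Field) (τ : ℝ)
    (U : ℝ → Field) : Prop where
  solves : SolvesDampedPE ν ω U₀ τ U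
  memC : MemCGevrey σ φ τ U
  memL2 : MemL2Gevrey (σ + 1 / 2) φ τ U

end DampedPE

end

noncomputable section

namespace DampedPE

/-! ### Frequencies -/

/-! The proof works on Fourier coefficients. Dividing by `damp ν t`, that is by `e^{-ν²t/2}`,
removes the linear term and leaves `∂_t V = g 𝒫 Q(V,V)` with a continuous scalar `g`, `|g| ≤ M`. By
evenness in `z` and the divergence-free barotropic part, the vertical velocity has coefficients
`-(k'·v_k)/k_3`, so `Q(V,V)` becomes a convolution whose symbol is at most `4 |j| |l|`
(`norm_transportSymbol_le`, `IsSeriesOf.coef_Q`): `w` costs one derivative of `V`, and no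
cancellation repairs this.

Analyticity does. Coefficients are measured with the weight `|k|^σ e^{ρ(t)|k|}`, whose radius `ρ(t)
= r - λt` shrinks linearly. In the Duhamel integral the weights at times `s < t` differ by the
factor `e^{-λ|k|(t-s)}`, whose time integral is at most `1/(λ|k|)`: the lost derivative is regained,
with a small factor `1/λ`. The unknowns are sequences whose supremum in time is taken mode by mode,
before the `ℓ²` sum (`SeqSpace`). A Young inequality, which needs `∑ |k|^{2-2σ} < ∞`, gives
`‖B(x,y)‖ ≤ K M/λ ‖x‖ ‖y‖` (`DuhamelData.norm_bilin_le`). A large `λ` makes the mild equation a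
contraction on a closed ball of admissible sequences (`DuhamelData.exists_fixedPoint`); the time is
limited only by keeping the radius nonnegative.

The radius `φ` of the theorem is taken below `φ₀ - 2λt`. The spare radius `λt` gives the factor
`e^{-λt|k|}`, hence the additional half derivative in `L²` of time (`IsMajorized.memL2Gevrey`).

For uniqueness, continuity on a compact interval bounds the weighted coefficients uniformly in time.
Giving up half of the radius turns this bound into a square-summable majorant valid at all times, so
the contraction estimate applies on successive short intervals of one fixed length
(`IsGevreySolution.unique`). -/

/-- The reflection `n ↦ (n₀, n₁, -n₂)` of the frequency lattice. -/
def reflectFreq (n : Fin 3 → ℤ) : Fin 3 → ℤ := Function.update n 2 (-n 2)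

theorem reflectFreq_reflectFreq (n : Fin 3 → ℤ) : reflectFreq (reflectFreq n) = n := by
  simp [reflectFreq]

/-- The reflection of the frequency lattice as a permutation. -/
def reflectFreqEquiv : (Fin 3 → ℤ) ≃ (Fin 3 → ℤ) where
  toFun := reflectFreq
  invFun := reflectFreq
  left_inv := reflectFreq_reflectFreq
  right_inv := reflectFreq_reflectFreq

@[simp] theorem reflectFreq_zero_apply (n : Fin 3 → ℤ) : reflectFreq n 0 = n 0 := by
  simp [reflectFreq]

@[simp] theorem reflectFreq_one_apply (n : Fin 3 → ℤ) : reflectFreq n 1 = n 1 := by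
  simp [reflectFreq]

@[simp] theorem reflectFreq_two_apply (n : Fin 3 → ℤ) : reflectFreq n 2 = -n 2 := by
  simp [reflectFreq]

theorem reflectFreq_sub (m n : Fin 3 → ℤ) :
    reflectFreq (m - n) = reflectFreq m - reflectFreq n := by
  ext j; fin_cases j <;> simp [sub_eq_add_neg, add_comm]

theorem freq_eq_norm (n : Fin 3 → ℤ) :
    freq n = 2 * Real.pi * ‖(WithLp.toLp 2 (fun j => (n j : ℝ)) : EuclideanSpace ℝ (Fin 3))‖ := by
  simp [freq, EuclideanSpace.norm_eq]

theorem freq_nonneg (n : Fin 3 → ℤ) : 0 ≤ freq n := by unfold freq; positivity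

@[simp] theorem freq_zero : freq 0 = 0 := by simp [freq]

theorem freq_add_le (m n : Fin 3 → ℤ) : freq (m + n) ≤ freq m + freq n := by
  rw [freq_eq_norm, freq_eq_norm, freq_eq_norm, ← mul_add]
  gcongr
  refine le_of_eq_of_le (congrArg _ ?_) (norm_add_le _ _)
  ext j; simp

theorem freq_le_add_sub (n j : Fin 3 → ℤ) : freq n ≤ freq j + freq (n - j) := by
  simpa using freq_add_le j (n - j)

theorem two_pi_mul_abs_le_freq (n : Fin 3 → ℤ) (j : Fin 3) :
    2 * Real.pi * |(n j : ℝ)| ≤ freq n := by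
  rw [freq_eq_norm]
  gcongr
  simpa using PiLp.norm_apply_le
    (WithLp.toLp 2 (fun j => (n j : ℝ)) : EuclideanSpace ℝ (Fin 3)) j

theorem abs_le_freq (n : Fin 3 → ℤ) (j : Fin 3) : |(n j : ℝ)| ≤ freq n := by
  have := two_pi_mul_abs_le_freq n j
  nlinarith [Real.pi_gt_three, abs_nonneg (n j : ℝ)]

theorem one_le_freq {n : Fin 3 → ℤ} (hn : n ≠ 0) : 1 ≤ freq n := by
  obtain ⟨j, hj⟩ := Function.ne_iff.mp hn
  refine le_trans ?_ (abs_le_freq n j)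
  exact_mod_cast Int.one_le_abs hj

theorem freq_pos {n : Fin 3 → ℤ} (hn : n ≠ 0) : 0 < freq n := by linarith [one_le_freq hn]

/-- Comparison with the norm sum over the lattice spanned by the standard basis, whose rank is `3`.
The norm there is the sup norm, which `freq` dominates; as `s < 0` this is the useful direction. The
zero frequency contributes `0 ^ s = 0`. -/
theorem summable_freq_rpow {s : ℝ} (hs : s < -3) : Summable fun n => freq n ^ s := by
  let b := Pi.basisFun ℝ (Fin 3)
  let L := Submodule.span ℤ (Set.range b)
  have hL : Module.finrank ℤ L = 3 := by
    rw [ZLattice.rank ℝ L]; simp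
  have key := ZLattice.summable_norm_rpow L s (by rw [hL]; exact_mod_cast hs)
  have hmem (n : Fin 3 → ℤ) : (fun j => (n j : ℝ)) ∈ L := by
    rw [Module.Basis.mem_span_iff_repr_mem]
    intro i
    exact ⟨n i, by simp [b]⟩
  let f : (Fin 3 → ℤ) → L := fun n => ⟨fun j => (n j : ℝ), hmem n⟩
  have hf : Function.Injective f := by
    intro m n h
    ext j
    have : (m j : ℝ) = n j := congrFun (congrArg Subtype.val h) j
    exact_mod_cast this
  refine Summable.of_nonneg_of_le (fun n => Real.rpow_nonneg (freq_nonneg n) _) (fun n => ?_)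
    (key.comp_injective hf)
  rcases eq_or_ne n 0 with rfl | hn
  · rw [freq_zero, Real.zero_rpow (by linarith)]
    exact Real.rpow_nonneg (norm_nonneg _) _
  · have hpos : 0 < ‖f n‖ := by
      rw [norm_pos_iff]
      intro h
      apply hn
      ext j
      have : (n j : ℝ) = 0 := congrFun (congrArg Subtype.val h) j
      exact_mod_cast this
    refine Real.rpow_le_rpow_of_nonpos hpos ?_ (by linarith)
    refine (pi_norm_le_iff_of_nonneg (freq_nonneg n)).2 fun j => ?_
    simpa using abs_le_freq n j

/-! ### Convolution estimates -/

theorem ennreal_add_sq_le (a b : ℝ≥0∞) : (a + b) ^ 2 ≤ 2 * (a ^ 2 + b ^ 2) := by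
  have := ENNReal.rpow_add_le_mul_rpow_add_rpow a b (p := 2) (by norm_num)
  norm_num at this
  exact_mod_cast this

theorem tsum_mul_sq_le {ι : Type*} [Countable ι] (f g : ι → ℝ≥0∞) :
    (∑' i, f i * g i) ^ 2 ≤ (∑' i, f i ^ 2) * ∑' i, g i ^ 2 := by
  let _ : MeasurableSpace ι := ⊤
  have h := ENNReal.lintegral_mul_le_Lp_mul_Lq (μ := Measure.count) (p := 2) (q := 2)
    (by rw [Real.holderConjugate_iff]; norm_num)
    (f := f) (g := g) (measurable_from_top.aemeasurable) (measurable_from_top.aemeasurable)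
  simp only [lintegral_count, Pi.mul_apply, one_div] at h
  calc _ ≤ ((∑' i, f i ^ (2 : ℝ)) ^ (2 : ℝ)⁻¹ * (∑' i, g i ^ (2 : ℝ)) ^ (2 : ℝ)⁻¹) ^ 2 := by
        gcongr
    _ = _ := by
        rw [mul_pow, ← ENNReal.rpow_two, ← ENNReal.rpow_two, ← ENNReal.rpow_mul,
          ← ENNReal.rpow_mul]
        norm_num

/-- Young's inequality `ℓ² * ℓ¹ ⊆ ℓ²`: Cauchy–Schwarz after writing `b` as `b^{1/2} b^{1/2}`, then
translation invariance of the sum. -/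
theorem tsum_convolution_sq_le {G : Type*} [AddCommGroup G] [Countable G]
    (a b : G → ℝ≥0∞) :
    ∑' n, (∑' j, a j * b (n - j)) ^ 2 ≤ (∑' j, a j ^ 2) * (∑' j, b j) ^ 2 := by
  have hshift (n : G) : ∑' j, b (n - j) = ∑' j, b j := (Equiv.subLeft n).tsum_eq b
  have hshift' (j : G) : ∑' n, b (n - j) = ∑' n, b n := (Equiv.subRight j).tsum_eq b
  have key (n : G) : (∑' j, a j * b (n - j)) ^ 2
      ≤ (∑' j, a j ^ 2 * b (n - j)) * ∑' j, b j := by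
    have h := tsum_mul_sq_le (fun j => a j * b (n - j) ^ (1 / 2 : ℝ))
      (fun j => b (n - j) ^ (1 / 2 : ℝ))
    have e (x : ℝ≥0∞) : (x ^ (1 / 2 : ℝ)) ^ 2 = x := by
      rw [← ENNReal.rpow_two, ← ENNReal.rpow_mul]; norm_num
    simp only [mul_assoc, ← pow_two, mul_pow, e, hshift] at h
    exact h
  calc _ ≤ ∑' n, (∑' j, a j ^ 2 * b (n - j)) * ∑' j, b j := ENNReal.tsum_le_tsum key
    _ = _ := by
      rw [ENNReal.tsum_mul_right, ENNReal.tsum_comm]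
      simp only [ENNReal.tsum_mul_left, hshift', ENNReal.tsum_mul_right]
      ring

/-- The sum of `|k|^{2 - 2σ}` over the nonzero frequencies. -/
def latticeSum (σ : ℝ) : ℝ≥0∞ := ∑' n, ENNReal.ofReal (freq n ^ (1 - σ)) ^ 2

/-- The exponent `2 - 2σ` lies below `-3` exactly when `σ > 5/2`; this is the origin of the
threshold on `σ`. -/
theorem latticeSum_lt_top {σ : ℝ} (hσ : 5 / 2 < σ) : latticeSum σ < ∞ := by
  have h : ∀ n, ENNReal.ofReal (freq n ^ (1 - σ)) ^ 2 = ENNReal.ofReal (freq n ^ (2 - 2 * σ)) := by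
    intro n
    rw [← ENNReal.ofReal_pow (Real.rpow_nonneg (freq_nonneg n) _), ← Real.rpow_natCast,
      ← Real.rpow_mul (freq_nonneg n)]
    congr 2
    push_cast; ring
  simp only [latticeSum, h]
  exact (summable_freq_rpow (by linarith)).tsum_ofReal_lt_top

/-- The weighted convolution that dominates the nonlinearity. -/
def kernelConv (σ : ℝ) (a b : (Fin 3 → ℤ) → ℝ≥0∞) (n : Fin 3 → ℤ) : ℝ≥0∞ :=
  ∑' j, (ENNReal.ofReal (freq j ^ (1 - σ)) * a j)
    * (ENNReal.ofReal (freq (n - j) ^ (1 - σ)) * b (n - j))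

/-- The larger of `|j|` and `|n - j|` is at least `|n|/2`, so its negative power absorbs `|n|^{σ-1}`
at the cost of `2^{σ-1}`; the smaller frequency keeps its negative power. If either frequency is
zero the left side vanishes, since `0 ^ (1 - σ) = 0`. -/
theorem freq_rpow_mul_le {σ : ℝ} (hσ : 1 < σ) (n j : Fin 3 → ℤ) :
    freq n ^ (σ - 1) * (freq j ^ (1 - σ) * freq (n - j) ^ (1 - σ))
      ≤ 2 ^ (σ - 1) * (freq j ^ (1 - σ) + freq (n - j) ^ (1 - σ)) := by
  have h0 (m) := Real.rpow_nonneg (freq_nonneg m)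
  rcases eq_or_ne j 0 with rfl | hj
  · rw [freq_zero, Real.zero_rpow (by linarith)]
    have := h0 (n - 0) (1 - σ)
    simp only [zero_mul, mul_zero, zero_add]
    positivity
  rcases eq_or_ne (n - j) 0 with hl | hl
  · rw [hl, freq_zero, Real.zero_rpow (by linarith)]
    have := h0 j (1 - σ)
    simp only [mul_zero, add_zero]
    positivity
  have hjp := freq_pos hj
  have hlp := freq_pos hl
  have hcancel {x : ℝ} (hx : 0 < x) : x ^ (σ - 1) * x ^ (1 - σ) = 1 := by
    rw [← Real.rpow_add hx]; norm_num
  rcases le_total (freq j) (freq (n - j)) with h | h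
  · have hn : freq n ^ (σ - 1) ≤ 2 ^ (σ - 1) * freq (n - j) ^ (σ - 1) := by
      rw [← Real.mul_rpow (by norm_num) hlp.le]
      exact Real.rpow_le_rpow (freq_nonneg n) (by linarith [freq_le_add_sub n j]) (by linarith)
    calc _ ≤ 2 ^ (σ - 1) * freq (n - j) ^ (σ - 1)
          * (freq j ^ (1 - σ) * freq (n - j) ^ (1 - σ)) := by
          gcongr
      _ = 2 ^ (σ - 1) * freq j ^ (1 - σ) * (freq (n - j) ^ (σ - 1) * freq (n - j) ^ (1 - σ)) := by
          ring
      _ ≤ _ := by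
          rw [hcancel hlp, mul_one]
          gcongr
          linarith [h0 (n - j) (1 - σ)]
  · have hn : freq n ^ (σ - 1) ≤ 2 ^ (σ - 1) * freq j ^ (σ - 1) := by
      rw [← Real.mul_rpow (by norm_num) hjp.le]
      exact Real.rpow_le_rpow (freq_nonneg n) (by linarith [freq_le_add_sub n j]) (by linarith)
    calc _ ≤ 2 ^ (σ - 1) * freq j ^ (σ - 1)
          * (freq j ^ (1 - σ) * freq (n - j) ^ (1 - σ)) := by
          gcongr
      _ = 2 ^ (σ - 1) * freq (n - j) ^ (1 - σ) * (freq j ^ (σ - 1) * freq j ^ (1 - σ)) := by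
          ring
      _ ≤ _ := by
          rw [hcancel hjp, mul_one]
          gcongr
          linarith [h0 j (1 - σ)]

/-- After the splitting of `freq_rpow_mul_le`, each half is an `ℓ² * ℓ¹` convolution; the `ℓ¹`
factor `|k|^{1-σ} c_k` is controlled by Cauchy–Schwarz and `latticeSum`. The `4` is a `2` from
squaring a sum times the two equal halves. -/
theorem tsum_sq_kernelConv_le {σ : ℝ} (hσ : 1 < σ) (a b : (Fin 3 → ℤ) → ℝ≥0∞) :
    ∑' n, (ENNReal.ofReal (freq n ^ (σ - 1)) * kernelConv σ a b n) ^ 2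
      ≤ 4 * ENNReal.ofReal (2 ^ (σ - 1)) ^ 2 * latticeSum σ
        * ((∑' n, a n ^ 2) * ∑' n, b n ^ 2) := by
  set p : (Fin 3 → ℤ) → ℝ≥0∞ := fun n => ENNReal.ofReal (freq n ^ (1 - σ)) with hp
  set C := ENNReal.ofReal (2 ^ (σ - 1)) with hC
  have h0 (m) := Real.rpow_nonneg (freq_nonneg m)
  have hker (n j) : ENNReal.ofReal (freq n ^ (σ - 1)) * (p j * p (n - j))
      ≤ C * (p j + p (n - j)) := by
    rw [hp, hC, ← ENNReal.ofReal_mul (h0 _ _), ← ENNReal.ofReal_mul (h0 _ _),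
      ← ENNReal.ofReal_add (h0 _ _) (h0 _ _), ← ENNReal.ofReal_mul (by positivity)]
    exact ENNReal.ofReal_le_ofReal (freq_rpow_mul_le hσ n j)
  have hL (c : (Fin 3 → ℤ) → ℝ≥0∞) : (∑' n, p n * c n) ^ 2 ≤ latticeSum σ * ∑' n, c n ^ 2 :=
    tsum_mul_sq_le p c
  have hpt (n) : ENNReal.ofReal (freq n ^ (σ - 1)) * kernelConv σ a b n
      ≤ C * ((∑' j, b j * (p (n - j) * a (n - j))) + ∑' j, a j * (p (n - j) * b (n - j))) := by
    have hflip : ∑' j, b j * (p (n - j) * a (n - j)) = ∑' j, b (n - j) * (p j * a j) := by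
      rw [← (Equiv.subLeft n).tsum_eq]; simp
    rw [hflip, kernelConv, ← ENNReal.tsum_mul_left, ← ENNReal.tsum_add, ← ENNReal.tsum_mul_left]
    refine ENNReal.tsum_le_tsum fun j => ?_
    calc _ = (ENNReal.ofReal (freq n ^ (σ - 1)) * (p j * p (n - j))) * (a j * b (n - j)) := by
          simp only [hp]; ring
      _ ≤ (C * (p j + p (n - j))) * (a j * b (n - j)) := by exact mul_le_mul_left (hker n j) _
      _ = _ := by ring
  calc _ ≤ ∑' n, C ^ 2 * (2 * ((∑' j, b j * (p (n - j) * a (n - j))) ^ 2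
          + (∑' j, a j * (p (n - j) * b (n - j))) ^ 2)) := by
        refine ENNReal.tsum_le_tsum fun n => (pow_le_pow_left' (hpt n) 2).trans ?_
        rw [mul_pow]
        gcongr
        exact ennreal_add_sq_le _ _
    _ ≤ C ^ 2 * (2 * ((∑' j, b j ^ 2) * (latticeSum σ * ∑' n, a n ^ 2)
          + (∑' j, a j ^ 2) * (latticeSum σ * ∑' n, b n ^ 2))) := by
        rw [ENNReal.tsum_mul_left, ENNReal.tsum_mul_left, ENNReal.tsum_add]
        gcongr
        · exact (tsum_convolution_sq_le b fun n => p n * a n).trans (by gcongr; exact hL a)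
        · exact (tsum_convolution_sq_le a fun n => p n * b n).trans (by gcongr; exact hL b)
    _ = _ := by ring

/-- Both factors are summable by Cauchy–Schwarz, and a convolution is at most the product of the two
sums. -/
theorem kernelConv_lt_top {σ : ℝ} (hσ : 5 / 2 < σ) {a b : (Fin 3 → ℤ) → ℝ≥0∞}
    (ha : ∑' n, a n ^ 2 < ∞) (hb : ∑' n, b n ^ 2 < ∞) (n : Fin 3 → ℤ) :
    kernelConv σ a b n < ∞ := by
  have hL {c : (Fin 3 → ℤ) → ℝ≥0∞} (hc : ∑' n, c n ^ 2 < ∞) :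
      ∑' n, ENNReal.ofReal (freq n ^ (1 - σ)) * c n < ∞ := by
    have := (tsum_mul_sq_le (fun n => ENNReal.ofReal (freq n ^ (1 - σ))) c).trans_lt
      (ENNReal.mul_lt_top (latticeSum_lt_top hσ) hc)
    exact (ENNReal.pow_lt_top_iff.1 this).resolve_right two_ne_zero
  refine lt_of_le_of_lt ?_ (ENNReal.mul_lt_top (hL ha) (hL hb))
  rw [kernelConv, ← ENNReal.tsum_mul_right]
  refine ENNReal.tsum_le_tsum fun j => ?_
  gcongr
  exact ENNReal.le_tsum (f := fun m => ENNReal.ofReal (freq m ^ (1 - σ)) * b m) (n - j)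

/-! ### The bilinear symbol and the convolution -/

/-- The values of Fourier coefficients of horizontal fields. -/
abbrev Vec : Type := Fin 2 → ℂ

/-- The symbol of `V ↦ u·∇_h V + w(u) ∂_z V` for `u` of frequency `j` and `V` of frequency `l`. -/
def transportSymbol (j l : Fin 3 → ℤ) (u : Vec) : ℂ :=
  2 * Real.pi * Complex.I *
    ((l 0 * u 0 + l 1 * u 1) - l 2 * ((j 0 * u 0 + j 1 * u 1) / j 2))

theorem transportSymbol_sub (j l : Fin 3 → ℤ) (u v : Vec) :
    transportSymbol j l (u - v) = transportSymbol j l u - transportSymbol j l v := by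
  simp only [transportSymbol, Pi.sub_apply]; ring

theorem transportSymbol_smul (j l : Fin 3 → ℤ) (c : ℝ) (u : Vec) :
    transportSymbol j l (c • u) = c * transportSymbol j l u := by
  simp only [transportSymbol, Pi.smul_apply, Complex.real_smul]; ring

theorem continuous_transportSymbol (j l : Fin 3 → ℤ) : Continuous (transportSymbol j l) := by
  unfold transportSymbol; fun_prop

/-- The horizontal part costs `|l|` only, the vertical part `|j| |l|`, because a nonzero integer `j
2` has modulus at least one. For `j 2 = 0` the quotient is `0` by convention, which is the correct
value for a divergence-free barotropic mode. Both parts fit under `|j| |l|` since `|j| ≥ 1` for `j ≠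
0`; this is why the mode `j = 0` must carry no velocity. -/
theorem norm_transportSymbol_le (j l : Fin 3 → ℤ) (u : Vec) (hu : j = 0 → u = 0) :
    ‖transportSymbol j l u‖ ≤ 4 * freq j * freq l * ‖u‖ := by
  rcases eq_or_ne j 0 with rfl | hj
  · simp [hu rfl, transportSymbol]
  have hu0 := norm_le_pi_norm u 0
  have hu1 := norm_le_pi_norm u 1
  have hj1 := one_le_freq hj
  have hl := freq_nonneg l
  have hdiv (i : Fin 3) : ‖(j i : ℂ)‖ / ‖(j 2 : ℂ)‖ ≤ freq j := by
    refine le_trans ?_ (abs_le_freq j i)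
    simp only [Complex.norm_intCast]
    rcases eq_or_ne (j 2) 0 with h | h
    · simp [h]
    · exact div_le_self (abs_nonneg _) (by exact_mod_cast Int.one_le_abs h)
  have hl' (i : Fin 3) : 2 * Real.pi * ‖(l i : ℂ)‖ ≤ freq l := by
    simpa using two_pi_mul_abs_le_freq l i
  have h1 : ‖(l 0 * u 0 + l 1 * u 1 : ℂ)‖ ≤ (‖(l 0 : ℂ)‖ + ‖(l 1 : ℂ)‖) * ‖u‖ := by
    refine (norm_add_le _ _).trans ?_
    rw [norm_mul, norm_mul, add_mul]
    gcongr
  have h2 : ‖((j 0 * u 0 + j 1 * u 1) / j 2 : ℂ)‖ ≤ (freq j + freq j) * ‖u‖ := by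
    rw [add_div, mul_div_right_comm, mul_div_right_comm]
    refine (norm_add_le _ _).trans ?_
    rw [norm_mul, norm_mul, norm_div, norm_div, add_mul]
    gcongr
    · exact hdiv 0
    · exact hdiv 1
  calc ‖transportSymbol j l u‖
      ≤ 2 * Real.pi * ((‖(l 0 : ℂ)‖ + ‖(l 1 : ℂ)‖) * ‖u‖
          + ‖(l 2 : ℂ)‖ * ((freq j + freq j) * ‖u‖)) := by
        rw [transportSymbol, norm_mul]
        have : ‖(2 * Real.pi * Complex.I : ℂ)‖ = 2 * Real.pi := by
          simp [abs_of_pos Real.pi_pos]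
        rw [this]
        gcongr
        refine (norm_sub_le _ _).trans ?_
        rw [norm_mul]
        gcongr
    _ = (2 * Real.pi * ‖(l 0 : ℂ)‖ + 2 * Real.pi * ‖(l 1 : ℂ)‖) * ‖u‖
          + 2 * Real.pi * ‖(l 2 : ℂ)‖ * ((freq j + freq j) * ‖u‖) := by ring
    _ ≤ (freq l + freq l) * ‖u‖ + freq l * ((freq j + freq j) * ‖u‖) := by
        gcongr
        · exact hl' 0
        · exact hl' 1
        · exact hl' 2
    _ ≤ _ := by nlinarith [mul_nonneg (mul_nonneg hl (norm_nonneg u)) (sub_nonneg.2 hj1)]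

/-- The Fourier coefficients of `Q(U,V)` in terms of those of `U` and `V`. -/
def transportConv (u v : (Fin 3 → ℤ) → Vec) (n : Fin 3 → ℤ) : Vec :=
  ∑' j, transportSymbol j (n - j) (u j) • v (n - j)

theorem leraySymbol_add (n : Fin 3 → ℤ) (a b : Vec) :
    leraySymbol n (a + b) = leraySymbol n a + leraySymbol n b := by
  unfold leraySymbol
  split_ifs
  · ext i; fin_cases i <;> simp <;> ring
  · rfl

theorem leraySymbol_smul (n : Fin 3 → ℤ) (c : ℂ) (a : Vec) :
    leraySymbol n (c • a) = c • leraySymbol n a := by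
  unfold leraySymbol
  split_ifs
  · ext i; fin_cases i <;> simp <;> ring
  · rfl

/-- The symbol of the hydrostatic Leray projection as a continuous linear map. -/
def leray (n : Fin 3 → ℤ) : Vec →L[ℂ] Vec :=
  LinearMap.toContinuousLinearMap
    { toFun := leraySymbol n
      map_add' := leraySymbol_add n
      map_smul' := leraySymbol_smul n }

theorem leray_apply (n : Fin 3 → ℤ) (a : Vec) : leray n a = leraySymbol n a := rfl

theorem norm_leray_le (n : Fin 3 → ℤ) (a : Vec) : ‖leray n a‖ ≤ 3 * ‖a‖ := by
  rw [leray_apply]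
  unfold leraySymbol
  have ha := norm_nonneg a
  split_ifs with h
  · have h0 := norm_le_pi_norm a 0
    have h1 := norm_le_pi_norm a 1
    set S : ℝ := (n 0 : ℝ) ^ 2 + (n 1 : ℝ) ^ 2 with hS
    have hS' : ‖((n 0 : ℂ) ^ 2 + (n 1 : ℂ) ^ 2)‖ = S := by
      rw [show ((n 0 : ℂ) ^ 2 + (n 1 : ℂ) ^ 2) = (S : ℂ) by rw [hS]; push_cast; rfl,
        Complex.norm_real, Real.norm_of_nonneg (by positivity)]
    have hb (i k : Fin 3) (hi : |(n i : ℝ)| * |(n k : ℝ)| ≤ S) (m : Fin 2) :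
        ‖(n i : ℂ)‖ * (‖(n k : ℂ)‖ * ‖a m‖) ≤ S * ‖a‖ := by
      rw [← mul_assoc, Complex.norm_intCast, Complex.norm_intCast]
      have hS0 : 0 ≤ S := by positivity
      gcongr
      exact norm_le_pi_norm a m
    have s0 := sq_abs (n 0 : ℝ)
    have s1 := sq_abs (n 1 : ℝ)
    have key (i : Fin 3) (hi0 : |(n i : ℝ)| * |(n 0 : ℝ)| ≤ S)
        (hi1 : |(n i : ℝ)| * |(n 1 : ℝ)| ≤ S) :
        ‖(n i : ℂ) * ((n 0 : ℂ) * a 0 + (n 1 : ℂ) * a 1) / ((n 0 : ℂ) ^ 2 + (n 1 : ℂ) ^ 2)‖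
          ≤ 2 * ‖a‖ := by
      rw [norm_div, hS', norm_mul]
      refine div_le_of_le_mul₀ (by positivity) (by positivity) ?_
      calc _ ≤ ‖(n i : ℂ)‖ * (‖(n 0 : ℂ)‖ * ‖a 0‖ + ‖(n 1 : ℂ)‖ * ‖a 1‖) := by
            gcongr
            refine (norm_add_le _ _).trans_eq ?_
            rw [norm_mul, norm_mul]
        _ ≤ 2 * ‖a‖ * S := by
            rw [mul_add]
            linarith [hb i 0 hi0 0, hb i 1 hi1 1]
    have e0 := key 0 (by nlinarith [sq_nonneg (n 1 : ℝ)])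
      (by nlinarith [sq_nonneg (|(n 0 : ℝ)| - |(n 1 : ℝ)|)])
    have e1 := key 1 (by nlinarith [sq_nonneg (|(n 0 : ℝ)| - |(n 1 : ℝ)|)])
      (by nlinarith [sq_nonneg (n 0 : ℝ)])
    refine (pi_norm_le_iff_of_nonneg (by positivity)).2 fun i => ?_
    fin_cases i
    · refine (norm_sub_le _ _).trans ?_
      linarith
    · refine (norm_sub_le _ _).trans ?_
      linarith
  · linarith

/-! ### The Duhamel operator on Chemin–Lerner spaces -/

/-- Sequences `n ↦ x n` of bounded continuous functions of time, with `∑ (sup_t |x n t|)² < ∞`. -/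
abbrev SeqSpace : Type := lp (fun _ : Fin 3 → ℤ => BoundedContinuousFunction ℝ Vec) 2

theorem SeqSpace.tsum_enorm_sq (x : SeqSpace) :
    ∑' n, ‖x n‖ₑ ^ 2 = ENNReal.ofReal (‖x‖ ^ 2) := by
  have h := lp.hasSum_norm (p := 2) (by norm_num) x
  simp only [ENNReal.toReal_ofNat, Real.rpow_two] at h
  rw [← h.tsum_eq, ENNReal.ofReal_tsum_of_nonneg (fun _ => by positivity) h.summable]
  refine tsum_congr fun n => ?_
  rw [ENNReal.ofReal_pow (norm_nonneg _), ofReal_norm]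

theorem SeqSpace.tsum_enorm_sq_lt_top (x : SeqSpace) : ∑' n, ‖x n‖ₑ ^ 2 < ∞ := by
  rw [x.tsum_enorm_sq]; exact ENNReal.ofReal_lt_top

theorem SeqSpace.memℓp_of_tsum {f : (Fin 3 → ℤ) → BoundedContinuousFunction ℝ Vec}
    (h : ∑' n, ‖f n‖ₑ ^ 2 < ∞) : Memℓp f 2 := by
  refine memℓp_gen ?_
  simp only [ENNReal.toReal_ofNat, Real.rpow_two]
  have := ENNReal.summable_toReal h.ne
  simpa using this

theorem SeqSpace.norm_le_of_tsum {x : SeqSpace} {C : ℝ} (hC : 0 ≤ C)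
    (h : ∑' n, ‖x n‖ₑ ^ 2 ≤ ENNReal.ofReal C ^ 2) : ‖x‖ ≤ C := by
  rw [x.tsum_enorm_sq, ← ENNReal.ofReal_pow hC, ENNReal.ofReal_le_ofReal_iff (by positivity)] at h
  exact (pow_le_pow_iff_left₀ (norm_nonneg _) hC two_ne_zero).1 h

/-- The Gevrey weight `|k|^σ e^{ρ|k|}`. -/
def weight (σ ρ : ℝ) (n : Fin 3 → ℤ) : ℝ := freq n ^ σ * Real.exp (ρ * freq n)

/-- The inverse `|k|^{-σ} e^{-ρ|k|}` of the Gevrey weight, zero at `k = 0`. -/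
def invWeight (σ ρ : ℝ) (n : Fin 3 → ℤ) : ℝ := freq n ^ (-σ) * Real.exp (-(ρ * freq n))

theorem weight_nonneg (σ ρ : ℝ) (n : Fin 3 → ℤ) : 0 ≤ weight σ ρ n :=
  mul_nonneg (Real.rpow_nonneg (freq_nonneg n) _) (Real.exp_nonneg _)

theorem invWeight_nonneg (σ ρ : ℝ) (n : Fin 3 → ℤ) : 0 ≤ invWeight σ ρ n :=
  mul_nonneg (Real.rpow_nonneg (freq_nonneg n) _) (Real.exp_nonneg _)

theorem weight_zero {σ : ℝ} (hσ : σ ≠ 0) (ρ : ℝ) : weight σ ρ 0 = 0 := by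
  simp [weight, Real.zero_rpow hσ]

theorem invWeight_zero {σ : ℝ} (hσ : σ ≠ 0) (ρ : ℝ) : invWeight σ ρ 0 = 0 := by
  simp [invWeight, Real.zero_rpow (neg_ne_zero.2 hσ)]

theorem weight_mul_invWeight (σ ρ : ℝ) {n : Fin 3 → ℤ} (hn : n ≠ 0) :
    weight σ ρ n * invWeight σ ρ n = 1 := by
  rw [weight, invWeight, mul_mul_mul_comm, ← Real.rpow_add (freq_pos hn), ← Real.exp_add]
  simp

/-- The clamping of the time to `[0, τ]`. -/
def clamp (τ t : ℝ) : ℝ := max 0 (min t τ)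

theorem continuous_clamp (τ : ℝ) : Continuous (clamp τ) := by unfold clamp; fun_prop

theorem clamp_mem {τ : ℝ} (hτ : 0 ≤ τ) (t : ℝ) : clamp τ t ∈ Icc 0 τ :=
  ⟨le_max_left _ _, max_le hτ (min_le_right _ _)⟩

theorem clamp_of_mem {τ t : ℝ} (ht : t ∈ Icc 0 τ) : clamp τ t = t := by
  rw [clamp, min_eq_left ht.2, max_eq_right ht.1]

/-- The gain of one derivative: it is used with `k` proportional to a frequency, uniformly in the
length `c` of the interval. -/
theorem integral_exp_decay_le {k : ℝ} (hk : 0 < k) (c : ℝ) :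
    ∫ s in (0 : ℝ)..c, Real.exp (-(k * (c - s))) ≤ 1 / k := by
  have h : ∀ s ∈ uIcc 0 c, HasDerivAt (fun s => Real.exp (-(k * (c - s))) / k)
      (Real.exp (-(k * (c - s)))) s := by
    intro s _
    have h1 : HasDerivAt (fun s => -(k * (c - s))) k s := by
      convert! (((hasDerivAt_id s).const_sub c).const_mul k).neg using 1
      simp
    have := h1.exp.div_const k
    rwa [mul_div_cancel_right₀ _ hk.ne'] at this
  rw [intervalIntegral.integral_eq_sub_of_hasDerivAt h
    (Continuous.intervalIntegrable (by fun_prop) _ _)]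
  simp only [sub_self, mul_zero, neg_zero, Real.exp_zero, sub_zero]
  have := Real.exp_nonneg (-(k * c))
  rw [sub_le_self_iff]
  positivity

/-- The data of the Duhamel operator: index `σ`, initial radius `r` shrinking at the rate `rate`,
on the time interval `[0, τ]`, with the coefficient `g` of size at most `M`. -/
structure DuhamelData where
  σ : ℝ
  r : ℝ
  rate : ℝ
  τ : ℝ
  M : ℝ
  g : ℝ → ℝ
  hσ : 5 / 2 < σ
  rate_pos : 0 < rate
  τ_nonneg : 0 ≤ τ
  radius_nonneg : rate * τ ≤ r
  M_nonneg : 0 ≤ M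
  continuous_g : Continuous g
  abs_g_le : ∀ t ∈ Icc 0 τ, |g t| ≤ M

namespace DuhamelData

variable (D : DuhamelData)

/-- The radius of analyticity at time `t`. -/
def radius (t : ℝ) : ℝ := D.r - D.rate * clamp D.τ t

theorem continuous_radius : Continuous D.radius := by
  have := continuous_clamp D.τ
  unfold radius; fun_prop

theorem zero_le_radius (t : ℝ) : 0 ≤ D.radius t := by
  have h := (clamp_mem D.τ_nonneg t).2
  have := mul_le_mul_of_nonneg_left h D.rate_pos.le
  have := D.radius_nonneg
  unfold radius; linarith

theorem σ_ne_zero : D.σ ≠ 0 := by linarith [D.hσ]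

/-- The Fourier coefficients encoded by a weighted sequence. -/
def phys (x : SeqSpace) (t : ℝ) (n : Fin 3 → ℤ) : Vec := invWeight D.σ (D.radius t) n • x n t

theorem phys_zero_apply (x : SeqSpace) (t : ℝ) : D.phys x t 0 = 0 := by
  simp [phys, invWeight_zero D.σ_ne_zero]

theorem phys_sub (x y : SeqSpace) (t : ℝ) : D.phys (x - y) t = D.phys x t - D.phys y t := by
  ext1 n
  simp [phys, smul_sub]

theorem continuous_phys (x : SeqSpace) (n : Fin 3 → ℤ) : Continuous fun t => D.phys x t n := by
  have := D.continuous_radius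
  have := (x n).continuous
  unfold phys invWeight
  fun_prop

theorem norm_phys_le (x : SeqSpace) (t : ℝ) (n : Fin 3 → ℤ) :
    ‖D.phys x t n‖ ≤ invWeight D.σ (D.radius t) n * ‖x n‖ := by
  rw [phys, norm_smul, Real.norm_of_nonneg (invWeight_nonneg _ _ _)]
  gcongr
  · exact invWeight_nonneg _ _ _
  · exact (x n).norm_coe_le_norm t

/-- The terms of the majorant of the convolution. -/
def major (x y : SeqSpace) (n j : Fin 3 → ℤ) : ℝ :=
  (freq j ^ (1 - D.σ) * ‖x j‖) * (freq (n - j) ^ (1 - D.σ) * ‖y (n - j)‖)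

theorem major_nonneg (x y : SeqSpace) (n j : Fin 3 → ℤ) : 0 ≤ D.major x y n j := by
  have h (m) := Real.rpow_nonneg (freq_nonneg m) (1 - D.σ)
  exact mul_nonneg (mul_nonneg (h _) (norm_nonneg _)) (mul_nonneg (h _) (norm_nonneg _))

theorem ofReal_major (x y : SeqSpace) (n j : Fin 3 → ℤ) :
    ENNReal.ofReal (D.major x y n j) = (ENNReal.ofReal (freq j ^ (1 - D.σ)) * ‖x j‖ₑ)
      * (ENNReal.ofReal (freq (n - j) ^ (1 - D.σ)) * ‖y (n - j)‖ₑ) := by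
  have h (m) := Real.rpow_nonneg (freq_nonneg m) (1 - D.σ)
  rw [major, ENNReal.ofReal_mul (mul_nonneg (h _) (norm_nonneg _)), ENNReal.ofReal_mul (h _),
    ENNReal.ofReal_mul (h _), ofReal_norm, ofReal_norm]

theorem tsum_ofReal_major (x y : SeqSpace) (n : Fin 3 → ℤ) :
    ∑' j, ENNReal.ofReal (D.major x y n j)
      = kernelConv D.σ (fun m => ‖x m‖ₑ) (fun m => ‖y m‖ₑ) n := by
  simp only [ofReal_major, kernelConv]

theorem summable_major (x y : SeqSpace) (n : Fin 3 → ℤ) : Summable (D.major x y n) := by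
  have h := kernelConv_lt_top D.hσ x.tsum_enorm_sq_lt_top y.tsum_enorm_sq_lt_top n
  rw [← tsum_ofReal_major] at h
  have := ENNReal.summable_toReal h.ne
  simpa only [ENNReal.toReal_ofReal (D.major_nonneg x y n _)] using this

theorem ofReal_tsum_major (x y : SeqSpace) (n : Fin 3 → ℤ) :
    ENNReal.ofReal (∑' j, D.major x y n j)
      = kernelConv D.σ (fun m => ‖x m‖ₑ) (fun m => ‖y m‖ₑ) n := by
  rw [ENNReal.ofReal_tsum_of_nonneg (D.major_nonneg x y n) (D.summable_major x y n),
    tsum_ofReal_major]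

theorem freq_mul_invWeight (ρ : ℝ) (n : Fin 3 → ℤ) :
    freq n * invWeight D.σ ρ n = freq n ^ (1 - D.σ) * Real.exp (-(ρ * freq n)) := by
  rcases eq_or_ne n 0 with rfl | hn
  · have := D.hσ
    simp [Real.zero_rpow (show 1 - D.σ ≠ 0 by linarith)]
  · rw [invWeight, ← mul_assoc, sub_eq_add_neg, Real.rpow_add (freq_pos hn), Real.rpow_one]

/-- Since the radius is nonnegative, `|n| ≤ |j| + |n - j|` lets the two decaying exponentials of the
factors be replaced by that of the output. The remaining majorant does not depend on time, because
it contains only suprema in time. -/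
theorem norm_term_le (x y : SeqSpace) (t : ℝ) (n j : Fin 3 → ℤ) :
    ‖transportSymbol j (n - j) (D.phys x t j) • D.phys y t (n - j)‖
      ≤ 4 * Real.exp (-(D.radius t * freq n)) * D.major x y n j := by
  have hρ := D.zero_le_radius t
  have hm := D.major_nonneg x y n j
  rw [norm_smul]
  calc _ ≤ (4 * freq j * freq (n - j) * (invWeight D.σ (D.radius t) j * ‖x j‖))
          * (invWeight D.σ (D.radius t) (n - j) * ‖y (n - j)‖) := by
        have h1 := freq_nonneg j
        have h2 := freq_nonneg (n - j)
        have h3 := norm_transportSymbol_le j (n - j) (D.phys x t j) (by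
          rintro rfl; exact D.phys_zero_apply x t)
        have h4 := invWeight_nonneg D.σ (D.radius t) j
        refine mul_le_mul (h3.trans ?_) (D.norm_phys_le y t _) (norm_nonneg _) (by positivity)
        gcongr
        exact D.norm_phys_le x t _
    _ = 4 * ((freq j * invWeight D.σ (D.radius t) j) * ‖x j‖)
          * ((freq (n - j) * invWeight D.σ (D.radius t) (n - j)) * ‖y (n - j)‖) := by ring
    _ = 4 * (Real.exp (-(D.radius t * freq j)) * Real.exp (-(D.radius t * freq (n - j))))
          * D.major x y n j := by
        rw [freq_mul_invWeight, freq_mul_invWeight, major]; ring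
    _ ≤ _ := by
        rw [← Real.exp_add]
        gcongr
        nlinarith [freq_le_add_sub n j]

theorem summable_term (x y : SeqSpace) (t : ℝ) (n : Fin 3 → ℤ) :
    Summable fun j => transportSymbol j (n - j) (D.phys x t j) • D.phys y t (n - j) :=
  Summable.of_norm_bounded ((D.summable_major x y n).mul_left _) (D.norm_term_le x y t n)

theorem norm_transportConv_le (x y : SeqSpace) (t : ℝ) (n : Fin 3 → ℤ) :
    ‖transportConv (D.phys x t) (D.phys y t) n‖
      ≤ 4 * Real.exp (-(D.radius t * freq n)) * ∑' j, D.major x y n j := by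
  rw [← tsum_mul_left]
  exact tsum_of_norm_bounded ((D.summable_major x y n).mul_left _).hasSum (D.norm_term_le x y t n)

theorem continuous_transportConv (x y : SeqSpace) (n : Fin 3 → ℤ) :
    Continuous fun t => transportConv (D.phys x t) (D.phys y t) n := by
  refine continuous_tsum (u := fun j => 4 * D.major x y n j) (fun j => ?_)
    ((D.summable_major x y n).mul_left _) (fun j t => (D.norm_term_le x y t n j).trans ?_)
  · exact ((continuous_transportSymbol _ _).comp (D.continuous_phys x j)).smul
      (D.continuous_phys y _)
  · have := D.major_nonneg x y n j
    have h1 : Real.exp (-(D.radius t * freq n)) ≤ 1 := by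
      rw [Real.exp_le_one_iff]
      nlinarith [mul_nonneg (D.zero_le_radius t) (freq_nonneg n)]
    nlinarith [mul_le_mul_of_nonneg_right h1 this]

/-- The integrand of the Duhamel formula. -/
def integrand (x y : SeqSpace) (n : Fin 3 → ℤ) (s : ℝ) : Vec :=
  D.g s • leray n (transportConv (D.phys x s) (D.phys y s) n)

theorem continuous_integrand (x y : SeqSpace) (n : Fin 3 → ℤ) :
    Continuous (D.integrand x y n) :=
  D.continuous_g.smul ((leray n).continuous.comp (D.continuous_transportConv x y n))

/-- The unweighted Duhamel integral. -/
def duhamel (x y : SeqSpace) (n : Fin 3 → ℤ) (t : ℝ) : Vec :=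
  ∫ s in (0 : ℝ)..clamp D.τ t, D.integrand x y n s

theorem continuous_duhamel (x y : SeqSpace) (n : Fin 3 → ℤ) :
    Continuous (D.duhamel x y n) := by
  have h := intervalIntegral.continuous_primitive
    (fun a b => (D.continuous_integrand x y n).intervalIntegrable (μ := volume) a b) 0
  exact h.comp (continuous_clamp D.τ)

/-- The exponential weights at times `s ≤ t` combine to `e^{-rate |n| (t-s)}`, whose integral is at
most `1/(rate |n|)`. Hence `|n|^σ` drops to `|n|^{σ-1}` and a factor `1/rate` appears. The `12` is
`3` from the Leray symbol times `4` from the transport symbol. -/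
theorem norm_weight_smul_duhamel_le (x y : SeqSpace) (n : Fin 3 → ℤ) (t : ℝ) :
    ‖weight D.σ (D.radius t) n • D.duhamel x y n t‖
      ≤ 12 * D.M / D.rate * (freq n ^ (D.σ - 1) * ∑' j, D.major x y n j) := by
  set S := ∑' j, D.major x y n j with hS
  have hS0 : 0 ≤ S := tsum_nonneg (D.major_nonneg x y n)
  have hM := D.M_nonneg
  have hrate := D.rate_pos
  rcases eq_or_ne n 0 with rfl | hn
  · rw [weight_zero D.σ_ne_zero, zero_smul, norm_zero]
    have := Real.rpow_nonneg (freq_nonneg 0) (D.σ - 1)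
    positivity
  have hf := freq_pos hn
  set c := clamp D.τ t with hc
  have hcm : c ∈ Icc 0 D.τ := clamp_mem D.τ_nonneg t
  have hint : ‖D.duhamel x y n t‖ ≤ ∫ s in (0 : ℝ)..c,
      12 * D.M * S * Real.exp (-(D.radius t * freq n))
        * Real.exp (-(D.rate * freq n * (c - s))) := by
    refine intervalIntegral.norm_integral_le_of_norm_le hcm.1 (Filter.Eventually.of_forall ?_)
      (Continuous.intervalIntegrable (by fun_prop) _ _)
    intro s hs
    have hsm : s ∈ Icc 0 D.τ := ⟨hs.1.le, hs.2.trans hcm.2⟩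
    rw [integrand, norm_smul]
    calc _ ≤ D.M * (3 * (4 * Real.exp (-(D.radius s * freq n)) * S)) := by
          gcongr
          · exact D.abs_g_le s hsm
          · exact (norm_leray_le n _).trans
              (mul_le_mul_of_nonneg_left (D.norm_transportConv_le x y s n) (by norm_num))
      _ = 12 * D.M * S * Real.exp (-(D.radius s * freq n)) := by ring
      _ = _ := by
          rw [mul_assoc _ (Real.exp _) (Real.exp _), ← Real.exp_add, radius, radius,
            clamp_of_mem hsm, ← hc]
          congr 2
          ring
  rw [norm_smul, Real.norm_of_nonneg (weight_nonneg _ _ _)]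
  calc _ ≤ weight D.σ (D.radius t) n * (12 * D.M * S * Real.exp (-(D.radius t * freq n))
          * (1 / (D.rate * freq n))) := by
        refine mul_le_mul_of_nonneg_left (hint.trans ?_) (weight_nonneg _ _ _)
        rw [intervalIntegral.integral_const_mul]
        gcongr
        exact integral_exp_decay_le (by positivity) c
    _ = 12 * D.M / D.rate * (freq n ^ D.σ / freq n * S)
          * (Real.exp (D.radius t * freq n) * Real.exp (-(D.radius t * freq n))) := by
        rw [weight]; field_simp
    _ = _ := by
        rw [← Real.exp_add, Real.rpow_sub_one hf.ne']; simp

/-- The components of the weighted Duhamel operator. -/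
def bilinAux (x y : SeqSpace) (n : Fin 3 → ℤ) : BoundedContinuousFunction ℝ Vec :=
  BoundedContinuousFunction.ofNormedAddCommGroup
    (fun t => weight D.σ (D.radius t) n • D.duhamel x y n t)
    (by
      have h1 := D.continuous_radius
      have h2 := D.continuous_duhamel x y n
      unfold weight
      fun_prop)
    _ (D.norm_weight_smul_duhamel_le x y n)

theorem enorm_bilinAux_le (x y : SeqSpace) (n : Fin 3 → ℤ) :
    ‖D.bilinAux x y n‖ₑ ≤ ENNReal.ofReal (12 * D.M / D.rate)
      * (ENNReal.ofReal (freq n ^ (D.σ - 1))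
        * kernelConv D.σ (fun m => ‖x m‖ₑ) (fun m => ‖y m‖ₑ) n) := by
  have hM := D.M_nonneg
  have hrate := D.rate_pos
  have h0 := Real.rpow_nonneg (freq_nonneg n) (D.σ - 1)
  have hS0 : 0 ≤ ∑' j, D.major x y n j := tsum_nonneg (D.major_nonneg x y n)
  rw [← ofReal_tsum_major, ← ENNReal.ofReal_mul h0, ← ENNReal.ofReal_mul (by positivity),
    ← ofReal_norm]
  refine ENNReal.ofReal_le_ofReal ?_
  exact BoundedContinuousFunction.norm_ofNormedAddCommGroup_le _ (by positivity)
    (D.norm_weight_smul_duhamel_le x y n)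

end DuhamelData

/-- The constant of the bilinear estimate. -/
def bilinConst (σ : ℝ) : ℝ :=
  12 * Real.sqrt (4 * ENNReal.ofReal (2 ^ (σ - 1)) ^ 2 * latticeSum σ).toReal

theorem bilinConst_nonneg (σ : ℝ) : 0 ≤ bilinConst σ := by unfold bilinConst; positivity

namespace DuhamelData

variable (D : DuhamelData)

theorem tsum_bilinAux_le (x y : SeqSpace) :
    ∑' n, ‖D.bilinAux x y n‖ₑ ^ 2
      ≤ ENNReal.ofReal (bilinConst D.σ * D.M / D.rate * (‖x‖ * ‖y‖)) ^ 2 := by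
  have hM := D.M_nonneg
  have hrate := D.rate_pos
  have hK := bilinConst_nonneg D.σ
  set L := 4 * ENNReal.ofReal (2 ^ (D.σ - 1)) ^ 2 * latticeSum D.σ with hL
  have hLtop : L < ∞ := ENNReal.mul_lt_top
    (ENNReal.mul_lt_top (by simp) (ENNReal.pow_lt_top ENNReal.ofReal_lt_top))
    (latticeSum_lt_top D.hσ)
  calc _ ≤ ∑' n, ENNReal.ofReal (12 * D.M / D.rate) ^ 2 * (ENNReal.ofReal (freq n ^ (D.σ - 1))
        * kernelConv D.σ (fun m => ‖x m‖ₑ) (fun m => ‖y m‖ₑ) n) ^ 2 := by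
        refine ENNReal.tsum_le_tsum fun n => ?_
        rw [← mul_pow]
        exact pow_le_pow_left' (D.enorm_bilinAux_le x y n) 2
    _ ≤ ENNReal.ofReal (12 * D.M / D.rate) ^ 2
          * (L * (ENNReal.ofReal (‖x‖ ^ 2) * ENNReal.ofReal (‖y‖ ^ 2))) := by
        rw [ENNReal.tsum_mul_left, ← x.tsum_enorm_sq, ← y.tsum_enorm_sq]
        gcongr
        exact tsum_sq_kernelConv_le (by linarith [D.hσ]) _ _
    _ = _ := by
        rw [← ENNReal.ofReal_toReal hLtop.ne, ← ENNReal.ofReal_pow (by positivity),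
          ← ENNReal.ofReal_pow (by positivity), ← ENNReal.ofReal_mul (by positivity),
          ← ENNReal.ofReal_mul (by positivity), ← ENNReal.ofReal_mul (by positivity),
          bilinConst, ← hL]
        congr 1
        have := Real.sq_sqrt (ENNReal.toReal_nonneg (a := L))
        field_simp
        rw [this]
        ring

/-- The weighted Duhamel operator. -/
def bilin (x y : SeqSpace) : SeqSpace :=
  ⟨D.bilinAux x y, SeqSpace.memℓp_of_tsum ((D.tsum_bilinAux_le x y).trans_lt
    (ENNReal.pow_lt_top ENNReal.ofReal_lt_top))⟩

theorem bilin_apply (x y : SeqSpace) (n : Fin 3 → ℤ) (t : ℝ) :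
    D.bilin x y n t = weight D.σ (D.radius t) n • D.duhamel x y n t := rfl

theorem norm_bilin_le (x y : SeqSpace) :
    ‖D.bilin x y‖ ≤ bilinConst D.σ * D.M / D.rate * (‖x‖ * ‖y‖) := by
  have hM := D.M_nonneg
  have hrate := D.rate_pos
  have hK := bilinConst_nonneg D.σ
  exact SeqSpace.norm_le_of_tsum (by positivity) (D.tsum_bilinAux_le x y)

theorem bilin_sub_left (x y z : SeqSpace) : D.bilin (x - y) z = D.bilin x z - D.bilin y z := by
  have hconv (n s) : transportConv (D.phys (x - y) s) (D.phys z s) n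
      = transportConv (D.phys x s) (D.phys z s) n
        - transportConv (D.phys y s) (D.phys z s) n := by
    rw [transportConv, transportConv, transportConv,
      ← (D.summable_term x z s n).tsum_sub (D.summable_term y z s n)]
    refine tsum_congr fun j => ?_
    rw [phys_sub, Pi.sub_apply, transportSymbol_sub, sub_smul]
  refine lp.ext (funext fun n => BoundedContinuousFunction.ext fun t => ?_)
  rw [lp.coeFn_sub, Pi.sub_apply, BoundedContinuousFunction.sub_apply, bilin_apply, bilin_apply,
    bilin_apply, ← smul_sub, duhamel, duhamel, duhamel, ← intervalIntegral.integral_sub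
      ((D.continuous_integrand x z n).intervalIntegrable _ _)
      ((D.continuous_integrand y z n).intervalIntegrable _ _)]
  simp only [integrand, hconv, map_sub, smul_sub]

theorem bilin_sub_right (x y z : SeqSpace) : D.bilin z (x - y) = D.bilin z x - D.bilin z y := by
  have hconv (n s) : transportConv (D.phys z s) (D.phys (x - y) s) n
      = transportConv (D.phys z s) (D.phys x s) n
        - transportConv (D.phys z s) (D.phys y s) n := by
    rw [transportConv, transportConv, transportConv,
      ← (D.summable_term z x s n).tsum_sub (D.summable_term z y s n)]
    refine tsum_congr fun j => ?_
    rw [phys_sub, Pi.sub_apply, smul_sub]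
  refine lp.ext (funext fun n => BoundedContinuousFunction.ext fun t => ?_)
  rw [lp.coeFn_sub, Pi.sub_apply, BoundedContinuousFunction.sub_apply, bilin_apply, bilin_apply,
    bilin_apply, ← smul_sub, duhamel, duhamel, duhamel, ← intervalIntegral.integral_sub
      ((D.continuous_integrand z x n).intervalIntegrable _ _)
      ((D.continuous_integrand z y n).intervalIntegrable _ _)]
  simp only [integrand, hconv, map_sub, smul_sub]

theorem norm_bilin_self_sub_le (x y : SeqSpace) :
    ‖D.bilin x x - D.bilin y y‖
      ≤ bilinConst D.σ * D.M / D.rate * ((‖x‖ + ‖y‖) * ‖x - y‖) := by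
  have h : D.bilin x x - D.bilin y y = D.bilin (x - y) x + D.bilin y (x - y) := by
    rw [bilin_sub_left, bilin_sub_right]; abel
  rw [h]
  refine (norm_add_le _ _).trans ?_
  linarith [D.norm_bilin_le (x - y) x, D.norm_bilin_le y (x - y)]

end DuhamelData

/-! ### Symmetries -/

/-- The conditions on the Fourier coefficients of real mean-zero fields that are even in `z` and
have a divergence-free barotropic part. -/
structure Admissible (v : (Fin 3 → ℤ) → Vec) : Prop where
  zero : v 0 = 0
  neg : ∀ n, v (-n) = star (v n)
  reflect : ∀ n, v (reflectFreq n) = v n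
  div_free : ∀ n : Fin 3 → ℤ, n 2 = 0 → (n 0 : ℂ) * v n 0 + (n 1 : ℂ) * v n 1 = 0

/-- Each condition involves finitely many coefficients, so it is closed for pointwise convergence.
This allows the contraction to be run inside the admissible sequences, so that the fixed point
inherits the symmetries. -/
theorem isClosed_admissible : IsClosed {v | Admissible v} := by
  have h : {v : (Fin 3 → ℤ) → Vec | Admissible v} = {v | v 0 = 0} ∩ {v | ∀ n, v (-n) = star (v n)}
      ∩ {v | ∀ n, v (reflectFreq n) = v n}
      ∩ {v | ∀ n : Fin 3 → ℤ, n 2 = 0 → (n 0 : ℂ) * v n 0 + (n 1 : ℂ) * v n 1 = 0} := by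
    ext v
    exact ⟨fun h => ⟨⟨⟨h.1, h.2⟩, h.3⟩, h.4⟩, fun h => ⟨h.1.1.1, h.1.1.2, h.1.2, h.2⟩⟩
  rw [h]
  simp only [Set.ofPred_forall]
  refine ((IsClosed.inter ?_ ?_).inter ?_).inter ?_
  · exact isClosed_eq (by fun_prop) continuous_const
  · exact isClosed_iInter fun n => isClosed_eq (by fun_prop) (by fun_prop)
  · exact isClosed_iInter fun n => isClosed_eq (by fun_prop) (by fun_prop)
  · exact isClosed_iInter fun n => isClosed_iInter fun _ =>
      isClosed_eq (by fun_prop) continuous_const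

theorem transportSymbol_neg_star (j l : Fin 3 → ℤ) (u : Vec) :
    transportSymbol (-j) (-l) (star u) = star (transportSymbol j l u) := by
  simp only [transportSymbol, Pi.neg_apply, Pi.star_apply, RCLike.star_def, map_mul, map_sub,
    map_add, map_div₀, Complex.conj_I, Complex.conj_ofReal, map_ofNat, map_intCast, Int.cast_neg]
  rw [show (-(j 0 : ℂ) * (starRingEnd ℂ) (u 0) + -(j 1 : ℂ) * (starRingEnd ℂ) (u 1)) / -(j 2 : ℂ)
    = (j 0 * (starRingEnd ℂ) (u 0) + j 1 * (starRingEnd ℂ) (u 1)) / j 2 by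
      rw [div_neg, ← neg_div]; ring]
  ring

theorem transportSymbol_reflectFreq (j l : Fin 3 → ℤ) (u : Vec) :
    transportSymbol (reflectFreq j) (reflectFreq l) u = transportSymbol j l u := by
  simp only [transportSymbol, reflectFreq_zero_apply, reflectFreq_one_apply,
    reflectFreq_two_apply, Int.cast_neg, div_neg]
  ring

theorem leraySymbol_neg_star (n : Fin 3 → ℤ) (a : Vec) :
    leraySymbol (-n) (star a) = star (leraySymbol n a) := by
  by_cases h : n 2 = 0
  · rw [leraySymbol, leraySymbol, if_pos (by simpa using h), if_pos h]
    ext i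
    fin_cases i <;> simp <;> ring
  · rw [leraySymbol, leraySymbol, if_neg (by simpa using h), if_neg h]

theorem leraySymbol_reflectFreq (n : Fin 3 → ℤ) (a : Vec) :
    leraySymbol (reflectFreq n) a = leraySymbol n a := by
  simp [leraySymbol]

theorem leraySymbol_div_free (n : Fin 3 → ℤ) (hn : n 2 = 0) (a : Vec) :
    (n 0 : ℂ) * leraySymbol n a 0 + (n 1 : ℂ) * leraySymbol n a 1 = 0 := by
  rw [leraySymbol, if_pos hn]
  simp only [Matrix.cons_val_zero, Matrix.cons_val_one]
  by_cases h : ((n 0 : ℂ) ^ 2 + (n 1 : ℂ) ^ 2) = 0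
  · have h' : (n 0 : ℝ) ^ 2 + (n 1 : ℝ) ^ 2 = 0 := by exact_mod_cast h
    have h0 : (n 0 : ℝ) = 0 := by nlinarith [sq_nonneg (n 0 : ℝ), sq_nonneg (n 1 : ℝ)]
    have h1 : (n 1 : ℝ) = 0 := by nlinarith [sq_nonneg (n 0 : ℝ), sq_nonneg (n 1 : ℝ)]
    have h0' : n 0 = 0 := by exact_mod_cast h0
    have h1' : n 1 = 0 := by exact_mod_cast h1
    simp [h0', h1']
  · field_simp
    ring

namespace Admissible

variable {v : (Fin 3 → ℤ) → Vec}

theorem transportConv_neg (hv : Admissible v) (n : Fin 3 → ℤ) :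
    transportConv v v (-n) = star (transportConv v v n) := by
  rw [transportConv, transportConv, tsum_star, ← (Equiv.neg _).tsum_eq]
  refine tsum_congr fun j => ?_
  rw [Equiv.neg_apply, star_smul, ← transportSymbol_neg_star, ← hv.neg, ← hv.neg]
  congr 2 <;> abel_nf

theorem transportConv_reflectFreq (hv : Admissible v) (n : Fin 3 → ℤ) :
    transportConv v v (reflectFreq n) = transportConv v v n := by
  rw [transportConv, transportConv, ← reflectFreqEquiv.tsum_eq]
  refine tsum_congr fun j => ?_
  change transportSymbol (reflectFreq j) (reflectFreq n - reflectFreq j) (v (reflectFreq j))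
    • v (reflectFreq n - reflectFreq j) = _
  rw [← reflectFreq_sub, hv.reflect, hv.reflect, transportSymbol_reflectFreq]

/-- The mean of `Q(U,U)` vanishes because the full velocity `(U, w)` is divergence free. On the
Fourier side `l = -j`: the horizontal and vertical parts cancel if `j 2 ≠ 0`, and the divergence
condition on the barotropic part handles `j 2 = 0`. -/
theorem transportConv_zero (hv : Admissible v) : transportConv v v 0 = 0 := by
  rw [transportConv]
  refine (tsum_congr fun j => ?_).trans tsum_zero
  have : transportSymbol j (0 - j) (v j) = 0 := by
    rw [transportSymbol]
    by_cases h : j 2 = 0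
    · have := hv.div_free j h
      simp only [zero_sub, Pi.neg_apply, h, neg_zero, Int.cast_zero, div_zero, zero_mul,
        Int.cast_neg]
      linear_combination (-2 * Real.pi * Complex.I) * this
    · have : (j 2 : ℂ) ≠ 0 := by exact_mod_cast h
      simp only [zero_sub, Pi.neg_apply, Int.cast_neg]
      field_simp
      ring
  rw [this, zero_smul]

end Admissible

namespace DuhamelData

variable (D : DuhamelData)

/-! ### Sequences from coefficients -/

theorem radius_of_mem {t : ℝ} (ht : t ∈ Icc 0 D.τ) : D.radius t = D.r - D.rate * t := by
  rw [radius, clamp_of_mem ht]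

theorem radius_clamp (t : ℝ) : D.radius (clamp D.τ t) = D.radius t := by
  rw [radius, radius, clamp_of_mem (clamp_mem D.τ_nonneg t)]

/-- The components of the weighted sequence of a family of Fourier coefficients. -/
def ofCoefAux (v : ℝ → (Fin 3 → ℤ) → Vec) (A : (Fin 3 → ℤ) → ℝ)
    (hc : ∀ n, ContinuousOn (fun t => v t n) (Icc 0 D.τ))
    (hb : ∀ t ∈ Icc 0 D.τ, ∀ n, weight D.σ (D.radius t) n * ‖v t n‖ ≤ A n)
    (n : Fin 3 → ℤ) : BoundedContinuousFunction ℝ Vec :=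
  BoundedContinuousFunction.ofNormedAddCommGroup
    (fun t => weight D.σ (D.radius t) n • v (clamp D.τ t) n)
    (by
      have h1 := D.continuous_radius
      have h2 : Continuous fun t => v (clamp D.τ t) n :=
        (hc n).comp_continuous (continuous_clamp _) (clamp_mem D.τ_nonneg)
      have h3 : Continuous fun t => weight D.σ (D.radius t) n := by unfold weight; fun_prop
      exact h3.smul h2)
    (A n) (fun t => by
      have := hb _ (clamp_mem D.τ_nonneg t) n
      rw [radius_clamp] at this
      rw [norm_smul, Real.norm_of_nonneg (weight_nonneg _ _ _)]
      exact this)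

/-- Passage from unweighted coefficients to `SeqSpace`. The majorant `A` must be uniform in time, as
the norm takes the supremum before summing; the zero mode must vanish because `invWeight` erases it.
-/
theorem exists_seq (v : ℝ → (Fin 3 → ℤ) → Vec) (A : (Fin 3 → ℤ) → ℝ) (C : ℝ)
    (hv : ∀ t ∈ Icc 0 D.τ, v t 0 = 0)
    (hc : ∀ n, ContinuousOn (fun t => v t n) (Icc 0 D.τ))
    (hb : ∀ t ∈ Icc 0 D.τ, ∀ n, weight D.σ (D.radius t) n * ‖v t n‖ ≤ A n)
    (hC : 0 ≤ C) (hA : ∑' n, ENNReal.ofReal (A n) ^ 2 ≤ ENNReal.ofReal C ^ 2) :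
    ∃ x : SeqSpace, ‖x‖ ≤ C ∧ (∀ t, D.phys x t = v (clamp D.τ t)) ∧
      ∀ n t, x n t = weight D.σ (D.radius t) n • v (clamp D.τ t) n := by
  have hsum : ∑' n, ‖D.ofCoefAux v A hc hb n‖ₑ ^ 2 ≤ ENNReal.ofReal C ^ 2 := by
    refine (ENNReal.tsum_le_tsum fun n => ?_).trans hA
    refine pow_le_pow_left' ?_ 2
    rw [← ofReal_norm]
    refine ENNReal.ofReal_le_ofReal ?_
    refine BoundedContinuousFunction.norm_ofNormedAddCommGroup_le _ ?_ _
    exact (mul_nonneg (weight_nonneg _ _ _) (norm_nonneg _)).trans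
      (hb _ (clamp_mem D.τ_nonneg 0) n)
  let x : SeqSpace := ⟨D.ofCoefAux v A hc hb,
    SeqSpace.memℓp_of_tsum (hsum.trans_lt (ENNReal.pow_lt_top ENNReal.ofReal_lt_top))⟩
  have hx (n t) : x n t = weight D.σ (D.radius t) n • v (clamp D.τ t) n := rfl
  refine ⟨x, SeqSpace.norm_le_of_tsum hC hsum, fun t => funext fun n => ?_, hx⟩
  rw [phys, hx]
  rcases eq_or_ne n 0 with rfl | hn
  · rw [hv _ (clamp_mem D.τ_nonneg t), smul_zero, smul_zero]
  · rw [smul_smul, mul_comm, weight_mul_invWeight _ _ hn, one_smul]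

theorem phys_add_bilin (x y : SeqSpace) (t : ℝ) {n : Fin 3 → ℤ} (hn : n ≠ 0) :
    D.phys (x + D.bilin y y) t n = D.phys x t n + D.duhamel y y n t := by
  rw [phys, lp.coeFn_add, Pi.add_apply, BoundedContinuousFunction.add_apply, smul_add, bilin_apply,
    smul_smul, mul_comm, weight_mul_invWeight _ _ hn, one_smul, phys]

theorem continuous_phys_left (t : ℝ) : Continuous fun x : SeqSpace => D.phys x t := by
  refine continuous_pi fun n => ?_
  have h1 : Continuous fun x : SeqSpace => x n :=
    (lp.lipschitzWith_one_eval (p := 2) n).continuous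
  have h2 : Continuous fun x : SeqSpace => x n t :=
    (BoundedContinuousFunction.evalCLM ℝ t).continuous.comp h1
  exact (continuous_const (y := invWeight D.σ (D.radius t) n)).smul h2

/-- Carries a linear symmetry of the integrand (conjugation, reflection) through the time integral.
-/
theorem duhamel_comm_of_integrand (L : Vec →L[ℝ] Vec) (x : SeqSpace) (m n : Fin 3 → ℤ)
    (h : ∀ s, D.integrand x x m s = L (D.integrand x x n s)) (t : ℝ) :
    D.duhamel x x m t = L (D.duhamel x x n t) := by
  rw [duhamel, duhamel, ← L.intervalIntegral_comp_comm
    ((D.continuous_integrand x x n).intervalIntegrable _ _)]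
  simp only [h]

theorem admissible_step {x y : SeqSpace} (hx : ∀ t, Admissible (D.phys x t))
    (hy : ∀ t, Admissible (D.phys y t)) (t : ℝ) : Admissible (D.phys (x + D.bilin y y) t) where
  zero := D.phys_zero_apply _ t
  neg n := by
    rcases eq_or_ne n 0 with rfl | hn
    · simp [phys_zero_apply]
    rw [phys_add_bilin _ _ _ _ hn, phys_add_bilin _ _ _ _ (neg_ne_zero.2 hn), (hx t).neg, star_add]
    congr 1
    refine D.duhamel_comm_of_integrand (starL' ℝ : Vec ≃L[ℝ] Vec) y (-n) n (fun s => ?_) t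
    simp only [ContinuousLinearEquiv.coe_coe, starL'_apply, integrand, star_smul, star_trivial]
    rw [leray_apply, (hy s).transportConv_neg, leraySymbol_neg_star, leray_apply]
  reflect n := by
    rcases eq_or_ne n 0 with rfl | hn
    · congr 1
      ext j; fin_cases j <;> simp
    have hn' : reflectFreq n ≠ 0 := by
      intro h
      apply hn
      rw [← reflectFreq_reflectFreq n, h]
      ext j; fin_cases j <;> simp
    rw [phys_add_bilin _ _ _ _ hn, phys_add_bilin _ _ _ _ hn', (hx t).reflect]
    congr 1
    refine D.duhamel_comm_of_integrand (ContinuousLinearMap.id ℝ Vec) y _ n (fun s => ?_) t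
    rw [ContinuousLinearMap.id_apply, integrand, integrand, leray_apply,
      (hy s).transportConv_reflectFreq, leraySymbol_reflectFreq, leray_apply]
  div_free n hn2 := by
    rcases eq_or_ne n 0 with rfl | hn
    · simp
    rw [phys_add_bilin _ _ _ _ hn]
    let p (i : Fin 2) : Vec →L[ℂ] ℂ := ContinuousLinearMap.proj (R := ℂ) (φ := fun _ => ℂ) i
    let L : Vec →L[ℝ] ℂ := ((n 0 : ℂ) • p 0 + (n 1 : ℂ) • p 1).restrictScalars ℝ
    have hL (a : Vec) : L a = n 0 * a 0 + n 1 * a 1 := rfl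
    have h0 : L (D.duhamel y y n t) = 0 := by
      rw [duhamel, ← L.intervalIntegral_comp_comm
        ((D.continuous_integrand y y n).intervalIntegrable _ _)]
      refine (intervalIntegral.integral_congr fun s _ => ?_).trans intervalIntegral.integral_zero
      change L (D.integrand y y n s) = 0
      rw [integrand, map_smul, hL, leray_apply, leraySymbol_div_free n hn2, smul_zero]
    rw [← hL, map_add, h0, hL, (hx t).div_free n hn2, add_zero]

/-! ### Existence and uniqueness of mild solutions -/

/-- With `κ` the bilinear constant, `8κR ≤ 1` gives `R + κ(2R)² ≤ 2R`, so the ball of radius `2R` is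
preserved, and the Lipschitz constant there is `4κR ≤ 1/2`. The smallness comes from a large
shrinking rate, not from a short time. -/
theorem exists_fixedPoint {x₀ : SeqSpace} {R : ℝ} (hR : 0 < R) (hx₀ : ‖x₀‖ ≤ R)
    (hadm : ∀ t, Admissible (D.phys x₀ t))
    (hsmall : 8 * bilinConst D.σ * D.M * R ≤ D.rate) :
    ∃ x : SeqSpace, x = x₀ + D.bilin x x ∧ ∀ t, Admissible (D.phys x t) := by
  have hM := D.M_nonneg
  have hrate := D.rate_pos
  have hK := bilinConst_nonneg D.σ
  set κ := bilinConst D.σ * D.M / D.rate with hκ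
  have hκ0 : 0 ≤ κ := by positivity
  have hκR : κ * (8 * R) ≤ 1 := by
    rw [hκ, div_mul_eq_mul_div, div_le_one hrate]; linarith
  let Φ : SeqSpace → SeqSpace := fun x => x₀ + D.bilin x x
  let S : Set SeqSpace := Metric.closedBall 0 (2 * R) ∩ ⋂ t, {x | Admissible (D.phys x t)}
  have hS : IsClosed S := Metric.isClosed_closedBall.inter
    (isClosed_iInter fun t => isClosed_admissible.preimage (D.continuous_phys_left t))
  have hmem {x} (hx : x ∈ S) : ‖x‖ ≤ 2 * R := by simpa using hx.1
  have hadm' {x} (hx : x ∈ S) (t) : Admissible (D.phys x t) := mem_iInter.1 hx.2 t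
  have hmaps : MapsTo Φ S S := by
    intro x hx
    refine ⟨?_, mem_iInter.2 fun t => D.admissible_step hadm (hadm' hx) t⟩
    rw [mem_closedBall_zero_iff]
    refine (norm_add_le _ _).trans ?_
    have h1 := D.norm_bilin_le x x
    have h2 : κ * (‖x‖ * ‖x‖) ≤ κ * (2 * R * (2 * R)) := by
      have := hmem hx
      gcongr
    nlinarith
  have hcontr : ContractingWith (1 / 2 : ℝ≥0) (hmaps.restrict Φ S S) := by
    refine ⟨by norm_num, LipschitzWith.of_dist_le_mul fun x y => ?_⟩
    rw [Subtype.dist_eq, Subtype.dist_eq, dist_eq_norm, dist_eq_norm]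
    change ‖(x₀ + D.bilin x x) - (x₀ + D.bilin y y)‖ ≤ _
    rw [add_sub_add_left_eq_sub]
    refine (D.norm_bilin_self_sub_le _ _).trans ?_
    have h1 : κ * (‖x.1‖ + ‖y.1‖) ≤ κ * (2 * R + 2 * R) := by
      have hx := hmem x.2
      have hy := hmem y.2
      gcongr
    have h2 : κ * (‖x.1‖ + ‖y.1‖) ≤ 1 / 2 := by linarith
    have := mul_le_mul_of_nonneg_right h2 (norm_nonneg (x.1 - y.1))
    push_cast
    linarith
  have hx₀S : x₀ ∈ S :=
    ⟨by rw [mem_closedBall_zero_iff]; linarith, mem_iInter.2 hadm⟩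
  obtain ⟨x, hxS, hx, -⟩ := hcontr.exists_fixedPoint' hS.isComplete hmaps hx₀S (edist_ne_top _ _)
  exact ⟨x, hx.symm, hadm' hxS⟩

/-- Integrating both equations from common data gives `x - y = B(x,x) - B(y,y)` for the weighted
sequences, whose norms are at most `C`. Then `‖x - y‖` is at most `2κC < 1` times itself. -/
theorem eq_of_mild {v w : ℝ → (Fin 3 → ℤ) → Vec} {A : (Fin 3 → ℤ) → ℝ} {C : ℝ}
    (hv : ∀ t ∈ Icc 0 D.τ, v t 0 = 0) (hw : ∀ t ∈ Icc 0 D.τ, w t 0 = 0)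
    (hvc : ∀ n, ContinuousOn (fun t => v t n) (Icc 0 D.τ))
    (hwc : ∀ n, ContinuousOn (fun t => w t n) (Icc 0 D.τ))
    (hvb : ∀ t ∈ Icc 0 D.τ, ∀ n, weight D.σ (D.radius t) n * ‖v t n‖ ≤ A n)
    (hwb : ∀ t ∈ Icc 0 D.τ, ∀ n, weight D.σ (D.radius t) n * ‖w t n‖ ≤ A n)
    (hC : 0 ≤ C) (hA : ∑' n, ENNReal.ofReal (A n) ^ 2 ≤ ENNReal.ofReal C ^ 2)
    (hv0 : ∀ n, v 0 n = w 0 n)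
    (hvd : ∀ t ∈ Icc 0 D.τ, ∀ n, HasDerivWithinAt (fun t => v t n)
      (D.g t • leray n (transportConv (v t) (v t) n)) (Icc 0 D.τ) t)
    (hwd : ∀ t ∈ Icc 0 D.τ, ∀ n, HasDerivWithinAt (fun t => w t n)
      (D.g t • leray n (transportConv (w t) (w t) n)) (Icc 0 D.τ) t)
    (hsmall : 2 * bilinConst D.σ * D.M * C < D.rate) :
    ∀ t ∈ Icc 0 D.τ, v t = w t := by
  have hM := D.M_nonneg
  have hrate := D.rate_pos
  have hK := bilinConst_nonneg D.σ
  have key (u : ℝ → (Fin 3 → ℤ) → Vec) (hc : ∀ n, ContinuousOn (fun t => u t n) (Icc 0 D.τ))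
      (hd : ∀ t ∈ Icc 0 D.τ, ∀ n, HasDerivWithinAt (fun t => u t n)
        (D.g t • leray n (transportConv (u t) (u t) n)) (Icc 0 D.τ) t)
      (x : SeqSpace) (hx : ∀ t, D.phys x t = u (clamp D.τ t)) (t : ℝ) (n : Fin 3 → ℤ) :
      D.duhamel x x n t = u (clamp D.τ t) n - u 0 n := by
    obtain ⟨hc0, hcτ⟩ := clamp_mem D.τ_nonneg t
    rw [duhamel]
    refine intervalIntegral.integral_eq_sub_of_hasDerivAt_of_le hc0
      ((hc n).mono (Icc_subset_Icc_right hcτ)) (fun s hs => ?_)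
      ((D.continuous_integrand x x n).intervalIntegrable _ _)
    have hsm : s ∈ Icc 0 D.τ := ⟨hs.1.le, hs.2.le.trans hcτ⟩
    rw [integrand, hx, clamp_of_mem hsm]
    exact (hd s hsm n).hasDerivAt (Icc_mem_nhds hs.1 (hs.2.trans_le hcτ))
  obtain ⟨x, hxC, hxp, hxa⟩ := D.exists_seq v A C hv hvc hvb hC hA
  obtain ⟨y, hyC, hyp, hya⟩ := D.exists_seq w A C hw hwc hwb hC hA
  have hxy : x - y = D.bilin x x - D.bilin y y := by
    refine lp.ext (funext fun n => BoundedContinuousFunction.ext fun t => ?_)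
    rw [lp.coeFn_sub, lp.coeFn_sub, Pi.sub_apply, Pi.sub_apply, BoundedContinuousFunction.sub_apply,
      BoundedContinuousFunction.sub_apply, bilin_apply, bilin_apply, hxa, hya, ← smul_sub,
      ← smul_sub, key v hvc hvd x hxp, key w hwc hwd y hyp, hv0]
    congr 1
    abel
  have hle := D.norm_bilin_self_sub_le x y
  rw [← hxy] at hle
  have hlt : bilinConst D.σ * D.M / D.rate * (C + C) < 1 := by
    rw [div_mul_eq_mul_div, div_lt_one hrate]; linarith
  have hle2 : ‖x - y‖ ≤ bilinConst D.σ * D.M / D.rate * (C + C) * ‖x - y‖ := by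
    refine hle.trans ?_
    rw [mul_assoc]
    gcongr
  have hzero : ‖x - y‖ = 0 := by nlinarith [norm_nonneg (x - y)]
  have heq : x = y := by rwa [norm_eq_zero, sub_eq_zero] at hzero
  intro t ht
  have := hxp t
  rw [heq, hyp t, clamp_of_mem ht] at this
  exact this.symm

end DuhamelData

/-! ### Absolutely convergent Fourier series on the torus -/

open UnitAddTorus in
theorem norm_mFourier_apply (n : Fin 3 → ℤ) (x : Torus3) : ‖mFourier n x‖ = 1 := by
  simp only [mFourier, ContinuousMap.coe_mk, norm_prod, fourier_apply, Circle.norm_coe,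
    Finset.prod_const_one]

open UnitAddTorus in
theorem mFourier_add_arg (n : Fin 3 → ℤ) (x y : Torus3) :
    mFourier n (x + y) = mFourier n x * mFourier n y := by
  simp only [mFourier, ContinuousMap.coe_mk, ← Finset.prod_mul_distrib]
  refine Finset.prod_congr rfl fun i _ => ?_
  rw [Pi.add_apply, fourier_apply, fourier_apply, fourier_apply, smul_add,
    AddCircle.toCircle_add, Circle.coe_mul]

open UnitAddTorus in
theorem mFourier_pi_single (n : Fin 3 → ℤ) (j : Fin 3) (h : UnitAddCircle) :
    mFourier n (Pi.single j h) = fourier (n j) h := by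
  simp only [mFourier, ContinuousMap.coe_mk]
  rw [Finset.prod_eq_single j]
  · rw [Pi.single_eq_same]
  · intro i _ hi
    rw [Pi.single_eq_of_ne hi, fourier_eval_zero]
  · simp

open UnitAddTorus in
theorem mFourier_reflectFreq (n : Fin 3 → ℤ) (x : Torus3) :
    mFourier (reflectFreq n) x = mFourier n (reflectZ x) := by
  simp [mFourier, Fin.prod_univ_three, reflectZ, fourier_apply]

/-- The sum of a Fourier series. -/
def fourierSeries (a : (Fin 3 → ℤ) → ℂ) (x : Torus3) : ℂ :=
  ∑' n, a n * UnitAddTorus.mFourier n x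

section fourierSeries

variable {a b : (Fin 3 → ℤ) → ℂ}

theorem summable_fourierSeries (ha : Summable fun n => ‖a n‖) (x : Torus3) :
    Summable fun n => ‖a n * UnitAddTorus.mFourier n x‖ := by
  simpa only [norm_mul, norm_mFourier_apply, mul_one] using ha

theorem summable_fourierSeries_apply (ha : Summable fun n => ‖a n‖) (x : Torus3) :
    Summable fun n => a n * UnitAddTorus.mFourier n x :=
  Summable.of_norm (f := fun n => a n * UnitAddTorus.mFourier n x) (summable_fourierSeries ha x)

theorem continuous_fourierSeries (ha : Summable fun n => ‖a n‖) :
    Continuous (fourierSeries a) := by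
  refine continuous_tsum (fun n => ?_) ha fun n x => ?_
  · exact continuous_const.mul (UnitAddTorus.mFourier n).continuous
  · rw [norm_mul, norm_mFourier_apply, mul_one]

instance : IsProbabilityMeasure torusMeasure := by unfold torusMeasure; infer_instance

theorem integral_mFourier (n : Fin 3 → ℤ) :
    ∫ x, UnitAddTorus.mFourier n x ∂torusMeasure = if n = 0 then 1 else 0 := by
  have h := (orthonormal_iff_ite.mp (UnitAddTorus.orthonormal_mFourier (d := Fin 3))) 0 n
  simp only [ContinuousMap.inner_toLp, UnitAddTorus.mFourier_zero, ContinuousMap.one_apply,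
    map_one, mul_one] at h
  simp only [eq_comm (a := n)]
  exact h

theorem mFourierCoeff_eq (f : Torus3 → ℂ) (n : Fin 3 → ℤ) :
    UnitAddTorus.mFourierCoeff f n
      = ∫ x, UnitAddTorus.mFourier (-n) x * f x ∂torusMeasure := rfl

theorem mFourierCoeff_fourierSeries (ha : Summable fun n => ‖a n‖) (n : Fin 3 → ℤ) :
    UnitAddTorus.mFourierCoeff (fourierSeries a) n = a n := by
  rw [mFourierCoeff_eq]
  have hterm (m : Fin 3 → ℤ) (x : Torus3) : UnitAddTorus.mFourier (-n) x
      * (a m * UnitAddTorus.mFourier m x) = a m * UnitAddTorus.mFourier (m - n) x := by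
    rw [sub_eq_add_neg, UnitAddTorus.mFourier_add]; ring
  have hint (m : Fin 3 → ℤ) : Integrable (fun x => a m * UnitAddTorus.mFourier (m - n) x)
      torusMeasure :=
    (Integrable.of_bound (UnitAddTorus.mFourier (m - n)).continuous.aestronglyMeasurable 1
      (Filter.Eventually.of_forall fun x => (norm_mFourier_apply _ x).le)).const_mul _
  have h := integral_tsum_of_summable_integral_norm hint (by
    simpa only [norm_mul, norm_mFourier_apply, mul_one, integral_const, probReal_univ, smul_eq_mul,
      one_mul] using ha)
  simp only [fourierSeries, ← tsum_mul_left, hterm]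
  rw [← h, tsum_eq_single n]
  · rw [integral_const_mul, integral_mFourier, sub_self, if_pos rfl, mul_one]
  · intro m hm
    rw [integral_const_mul, integral_mFourier, if_neg (sub_ne_zero.2 hm), mul_zero]

/-- The convolution of two sequences. -/
def seqConv (a b : (Fin 3 → ℤ) → ℂ) (n : Fin 3 → ℤ) : ℂ := ∑' j, a j * b (n - j)

/-- The shear `(n, j) ↦ (j, n - j)`. -/
def shearEquiv : (Fin 3 → ℤ) × (Fin 3 → ℤ) ≃ (Fin 3 → ℤ) × (Fin 3 → ℤ) where
  toFun p := (p.2, p.1 - p.2)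
  invFun q := (q.1 + q.2, q.1)
  left_inv p := by ext <;> simp
  right_inv q := by ext <;> simp

theorem summable_prod_conv (ha : Summable fun n => ‖a n‖) (hb : Summable fun n => ‖b n‖) :
    Summable fun p : (Fin 3 → ℤ) × (Fin 3 → ℤ) => ‖a p.2 * b (p.1 - p.2)‖ := by
  have h := Summable.comp_injective (Summable.mul_norm (f := a) (g := b) ha hb)
    shearEquiv.injective
  simp only [Function.comp_def, shearEquiv, Equiv.coe_fn_mk] at h
  exact h

theorem summable_conv_term (ha : Summable fun n => ‖a n‖) (hb : Summable fun n => ‖b n‖)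
    (n : Fin 3 → ℤ) : Summable fun j => a j * b (n - j) :=
  ((summable_prod_conv ha hb).prod_factor n).of_norm

theorem summable_seqConv (ha : Summable fun n => ‖a n‖) (hb : Summable fun n => ‖b n‖) :
    Summable fun n => ‖seqConv a b n‖ := by
  have h := summable_prod_conv ha hb
  refine Summable.of_nonneg_of_le (fun _ => norm_nonneg _) (fun n => ?_) h.prod
  exact norm_tsum_le_tsum_norm (h.prod_factor n)

theorem fourierSeries_mul (ha : Summable fun n => ‖a n‖) (hb : Summable fun n => ‖b n‖)
    (x : Torus3) :
    fourierSeries a x * fourierSeries b x = fourierSeries (seqConv a b) x := by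
  have hab := summable_mul_of_summable_norm (summable_fourierSeries ha x)
    (summable_fourierSeries hb x)
  have hab' := (shearEquiv.summable_iff).2 hab
  simp only [Function.comp_def] at hab'
  rw [fourierSeries, fourierSeries, tsum_mul_tsum_of_summable_norm (summable_fourierSeries ha x)
    (summable_fourierSeries hb x), ← shearEquiv.tsum_eq, Summable.tsum_prod hab']
  refine tsum_congr fun n => ?_
  rw [seqConv, ← tsum_mul_right]
  refine tsum_congr fun j => ?_
  change a j * UnitAddTorus.mFourier j x * (b (n - j) * UnitAddTorus.mFourier (n - j) x) = _
  have : UnitAddTorus.mFourier n x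
      = UnitAddTorus.mFourier j x * UnitAddTorus.mFourier (n - j) x := by
    rw [← UnitAddTorus.mFourier_add, add_sub_cancel]
  rw [this]; ring

theorem fourierSeries_add (ha : Summable fun n => ‖a n‖) (hb : Summable fun n => ‖b n‖)
    (x : Torus3) :
    fourierSeries a x + fourierSeries b x = fourierSeries (fun n => a n + b n) x := by
  rw [fourierSeries, fourierSeries, ← (summable_fourierSeries_apply ha x).tsum_add
    (summable_fourierSeries_apply hb x)]
  exact tsum_congr fun n => by ring

/-- The Fourier coefficients of the partial derivative `∂_j`. -/
def dCoef (j : Fin 3) (a : (Fin 3 → ℤ) → ℂ) (n : Fin 3 → ℤ) : ℂ :=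
  2 * Real.pi * Complex.I * n j * a n

theorem norm_dCoef_le (j : Fin 3) (a : (Fin 3 → ℤ) → ℂ) (n : Fin 3 → ℤ) :
    ‖dCoef j a n‖ ≤ freq n * ‖a n‖ := by
  rw [dCoef, norm_mul]
  gcongr
  refine le_of_eq_of_le ?_ (two_pi_mul_abs_le_freq n j)
  simp [abs_of_pos Real.pi_pos]

theorem summable_dCoef (ha : Summable fun n => freq n * ‖a n‖) (j : Fin 3) :
    Summable fun n => ‖dCoef j a n‖ :=
  Summable.of_nonneg_of_le (fun _ => norm_nonneg _) (norm_dCoef_le j a) ha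

theorem summable_norm_of_freq (ha : Summable fun n => freq n * ‖a n‖) :
    Summable fun n => ‖a n‖ := by
  refine (Summable.add ha (summable_of_ne_finset_zero (f := fun n => if n = 0 then ‖a 0‖ else 0)
    (s := {0}) fun n hn => if_neg (by simpa using hn))).of_nonneg_of_le
    (fun _ => norm_nonneg _) fun n => ?_
  rcases eq_or_ne n 0 with rfl | hn
  · simp
  · rw [if_neg hn, add_zero]
    exact le_mul_of_one_le_left (norm_nonneg _) (one_le_freq hn)

theorem hasDerivAt_character (m : ℤ) (y : ℝ) :
    HasDerivAt (fun y : ℝ => fourier m (y : UnitAddCircle))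
      (2 * Real.pi * Complex.I * m * fourier m (y : UnitAddCircle)) y := by
  have h := hasDerivAt_fourier 1 m y
  rwa [Complex.ofReal_one, div_one] at h

theorem hasDerivAt_const_mul_character (c d : ℂ) (m : ℤ) (y : ℝ) :
    HasDerivAt (fun y : ℝ => c * (d * fourier m (y : UnitAddCircle)))
      (2 * Real.pi * Complex.I * m * c * (d * fourier m (y : UnitAddCircle))) y := by
  have h := ((hasDerivAt_character m y).const_mul d).const_mul c
  have e : c * (d * (2 * Real.pi * Complex.I * m * fourier m (y : UnitAddCircle)))
    = 2 * Real.pi * Complex.I * m * c * (d * fourier m (y : UnitAddCircle)) := by ring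
  rw [e] at h
  exact h

theorem hasDerivAt_fourierSeries (ha : Summable fun n => ‖a n‖) {j : Fin 3}
    (hd : Summable fun n => ‖dCoef j a n‖) (x : Torus3) (h : ℝ) :
    HasDerivAt (fun h : ℝ => fourierSeries a (x + Pi.single j (h : UnitAddCircle)))
      (fourierSeries (dCoef j a) (x + Pi.single j (h : UnitAddCircle))) h := by
  have h0 := summable_fourierSeries_apply ha (x + Pi.single j (h : UnitAddCircle))
  have hg (n : Fin 3 → ℤ) (y : ℝ) : HasDerivAt
      (fun y : ℝ => a n * UnitAddTorus.mFourier n (x + Pi.single j (y : UnitAddCircle)))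
      (dCoef j a n * UnitAddTorus.mFourier n (x + Pi.single j (y : UnitAddCircle))) y := by
    simp only [mFourier_add_arg, mFourier_pi_single, dCoef]
    exact hasDerivAt_const_mul_character _ _ _ _
  have hb (n : Fin 3 → ℤ) (y : ℝ) :
      ‖dCoef j a n * UnitAddTorus.mFourier n (x + Pi.single j (y : UnitAddCircle))‖
        ≤ ‖dCoef j a n‖ := by
    rw [norm_mul, norm_mFourier_apply, mul_one]
  have hsum := hasDerivAt_tsum hd hg hb h0 h
  simp only [fourierSeries]
  exact hsum

theorem fourierSeries_star (x : Torus3) (h : ∀ n, a (-n) = star (a n)) :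
    star (fourierSeries a x) = fourierSeries a x := by
  rw [fourierSeries, tsum_star, ← (Equiv.neg _).tsum_eq]
  refine tsum_congr fun n => ?_
  rw [Equiv.neg_apply, star_mul', h, star_star, UnitAddTorus.mFourier_neg, RCLike.star_def,
    Complex.conj_conj]

theorem fourierSeries_reflectZ (x : Torus3) :
    fourierSeries a (reflectZ x) = fourierSeries (fun n => a (reflectFreq n)) x := by
  rw [fourierSeries, fourierSeries, ← reflectFreqEquiv.tsum_eq]
  refine tsum_congr fun n => ?_
  change a (reflectFreq n) * _ = _
  rw [← mFourier_reflectFreq]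
  change _ * UnitAddTorus.mFourier (reflectFreq (reflectFreq n)) x = _
  rw [reflectFreq_reflectFreq]

/-- Points with `z = 0` are fixed by the reflection, so an odd function vanishes there. It supplies
the boundary value `w = 0` at `z = 0`. -/
theorem fourierSeries_eq_zero_of_odd {x : Torus3} (hx : x 2 = 0)
    (h : ∀ n, a (reflectFreq n) = -a n) : fourierSeries a x = 0 := by
  have h1 : reflectZ x = x := by
    rw [reflectZ, hx, neg_zero, ← hx, Function.update_eq_self]
  have h2 := fourierSeries_reflectZ (a := a) x
  rw [h1] at h2
  simp only [h] at h2
  have h3 : fourierSeries (fun n => -a n) x = -fourierSeries a x := by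
    rw [fourierSeries, fourierSeries, ← tsum_neg]
    exact tsum_congr fun n => by ring
  rw [h3] at h2
  linear_combination (1 / 2 : ℂ) * h2

theorem contDiff_fourierSeries (ha : Summable fun n => freq n * ‖a n‖) :
    ContDiff ℝ 1 fun y : Fin 3 → ℝ => fourierSeries a fun j => (y j : UnitAddCircle) := by
  have ha0 := summable_norm_of_freq ha
  let L (n : Fin 3 → ℤ) : (Fin 3 → ℝ) →L[ℝ] ℂ :=
    ∑ j, (2 * Real.pi * Complex.I * n j : ℂ) •
      (Complex.ofRealCLM.comp (ContinuousLinearMap.proj (R := ℝ) (φ := fun _ => ℝ) j))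
  have hL (n) (y : Fin 3 → ℝ) : L n y = ∑ j, 2 * Real.pi * Complex.I * n j * y j := by
    simp [L]
  have hexp (n : Fin 3 → ℤ) (y : Fin 3 → ℝ) :
      UnitAddTorus.mFourier n (fun j => (y j : UnitAddCircle)) = Complex.exp (L n y) := by
    rw [hL, Complex.exp_sum]
    simp only [UnitAddTorus.mFourier, ContinuousMap.coe_mk, fourier_coe_apply]
    refine Finset.prod_congr rfl fun j _ => ?_
    simp
  have hLn (n) : ‖L n‖ ≤ 3 * freq n := by
    refine (norm_sum_le _ _).trans ?_
    refine (Finset.sum_le_card_nsmul _ _ (freq n) fun j _ => ?_).trans_eq (by simp)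
    have h1 : ‖(2 * Real.pi * Complex.I * n j : ℂ)‖ ≤ freq n := by
      refine le_of_eq_of_le ?_ (two_pi_mul_abs_le_freq n j)
      simp [abs_of_pos Real.pi_pos]
    have h2 : ‖Complex.ofRealCLM.comp
        (ContinuousLinearMap.proj (R := ℝ) (φ := fun _ : Fin 3 => ℝ) j)‖ ≤ 1 := by
      refine ContinuousLinearMap.opNorm_le_bound _ zero_le_one fun y => ?_
      simpa using norm_le_pi_norm y j
    rw [norm_smul]
    nlinarith [norm_nonneg (2 * Real.pi * Complex.I * n j : ℂ), freq_nonneg n]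
  have hnorm (n) (y : Fin 3 → ℝ) : ‖Complex.exp (L n y)‖ = 1 := by
    rw [← hexp, norm_mFourier_apply]
  have hd (n) (y : Fin 3 → ℝ) :
      HasFDerivAt (fun y => a n * Complex.exp (L n y)) (a n • Complex.exp (L n y) • L n) y :=
    (((L n).hasFDerivAt).cexp).const_mul (a n)
  unfold fourierSeries
  simp only [hexp]
  refine contDiff_tsum (v := fun k n => if k = 0 then ‖a n‖ else 3 * (freq n * ‖a n‖))
    (fun n => ?_) (fun k _ => ?_) fun k n y hk => ?_
  · exact contDiff_const.mul (L n).contDiff.cexp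
  · by_cases h : k = 0
    · simpa [h] using ha0
    · simpa [h] using ha.mul_left 3
  · have hk1 : k ≤ 1 := by exact_mod_cast hk
    interval_cases k
    · rw [norm_iteratedFDeriv_zero, norm_mul, hnorm]; simp
    · rw [norm_iteratedFDeriv_one, (hd n y).fderiv, norm_smul, norm_smul, hnorm]
      simp only [one_mul, one_ne_zero, if_false]
      nlinarith [hLn n, norm_nonneg (a n)]

end fourierSeries

/-! ### Fields given by Fourier series -/

/-- `V` is the sum of the Fourier series with admissible coefficients `v`, and the series of the
first derivatives converges absolutely. -/
structure IsSeriesOf (v : (Fin 3 → ℤ) → Vec) (V : Field) : Prop where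
  admissible : Admissible v
  summable : Summable fun n => freq n * ‖v n‖
  eq_series : ∀ x i, ((V x i : ℝ) : ℂ) = fourierSeries (fun n => v n i) x

theorem ofReal_deriv_eq {f : ℝ → ℝ} {g : ℝ → ℂ} {d : ℂ} {t : ℝ} (hfg : ∀ s, (f s : ℂ) = g s)
    (h : HasDerivAt g d t) : ((deriv f t : ℝ) : ℂ) = d := by
  have hg : g = fun s => (f s : ℂ) := funext fun s => (hfg s).symm
  have h1 : HasDerivAt f d.re t := by
    have := (Complex.reCLM.hasFDerivAt (x := g t)).comp_hasDerivAt t h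
    rw [hg] at this
    exact this
  have h2 := h1.ofReal_comp
  rw [← hg] at h2
  rw [h1.deriv]
  exact h2.unique h

namespace IsSeriesOf

variable {v : (Fin 3 → ℤ) → Vec} {V : Field}

theorem summable_freq_apply (h : IsSeriesOf v V) (i : Fin 2) :
    Summable fun n => freq n * ‖v n i‖ :=
  Summable.of_nonneg_of_le (fun n => mul_nonneg (freq_nonneg n) (norm_nonneg _))
    (fun n => mul_le_mul_of_nonneg_left (norm_le_pi_norm (v n) i) (freq_nonneg n)) h.summable

theorem summable_apply (h : IsSeriesOf v V) (i : Fin 2) : Summable fun n => ‖v n i‖ :=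
  summable_norm_of_freq (h.summable_freq_apply i)

theorem coef_eq (h : IsSeriesOf v V) (n : Fin 3 → ℤ) (i : Fin 2) : coef V n i = v n i := by
  rw [coef, show (fun x => ((V x i : ℝ) : ℂ)) = fourierSeries (fun n => v n i) from
    funext fun x => h.eq_series x i, mFourierCoeff_fourierSeries (h.summable_apply i)]

theorem coef_eq_fun (h : IsSeriesOf v V) : coef V = v :=
  funext fun n => funext fun i => h.coef_eq n i

theorem pd_eq (h : IsSeriesOf v V) (j : Fin 3) (i : Fin 2) (x : Torus3) :
    ((pd j (fun y => V y i) x : ℝ) : ℂ) = fourierSeries (dCoef j fun n => v n i) x := by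
  have hd := hasDerivAt_fourierSeries (h.summable_apply i)
    (summable_dCoef (h.summable_freq_apply i) j) x 0
  have := ofReal_deriv_eq (fun s => h.eq_series _ i) hd
  rw [pd, this, AddCircle.coe_zero, Pi.single_zero, add_zero]

/-- The Fourier coefficients of the horizontal divergence. -/
def divCoef (v : (Fin 3 → ℤ) → Vec) (n : Fin 3 → ℤ) : ℂ :=
  dCoef 0 (fun n => v n 0) n + dCoef 1 (fun n => v n 1) n

/-- The Fourier coefficients of the vertical velocity. -/
def vertCoef (v : (Fin 3 → ℤ) → Vec) (n : Fin 3 → ℤ) : ℂ :=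
  -((n 0 * v n 0 + n 1 * v n 1) / n 2)

theorem divh_eq (h : IsSeriesOf v V) (x : Torus3) :
    ((divh V x : ℝ) : ℂ) = fourierSeries (divCoef v) x := by
  rw [divh, Complex.ofReal_add, h.pd_eq, h.pd_eq,
    fourierSeries_add (summable_dCoef (h.summable_freq_apply 0) 0)
      (summable_dCoef (h.summable_freq_apply 1) 1)]
  rfl

theorem summable_divCoef (h : IsSeriesOf v V) : Summable fun n => ‖divCoef v n‖ :=
  Summable.of_nonneg_of_le (fun _ => norm_nonneg _) (fun _ => norm_add_le _ _)
    ((summable_dCoef (h.summable_freq_apply 0) 0).add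
      (summable_dCoef (h.summable_freq_apply 1) 1))

theorem dCoef_vertCoef (h : IsSeriesOf v V) (n : Fin 3 → ℤ) :
    dCoef 2 (vertCoef v) n = -divCoef v n := by
  rw [divCoef, dCoef, dCoef, dCoef, vertCoef]
  by_cases hn : n 2 = 0
  · have := h.admissible.div_free n hn
    rw [hn]
    simp only [Int.cast_zero, mul_zero, zero_mul]
    linear_combination (2 * Real.pi * Complex.I) * this
  · have : (n 2 : ℂ) ≠ 0 := by exact_mod_cast hn
    field_simp

theorem norm_vertCoef_le (v : (Fin 3 → ℤ) → Vec) (n : Fin 3 → ℤ) :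
    ‖vertCoef v n‖ ≤ freq n * ‖v n 0‖ + freq n * ‖v n 1‖ := by
  have hn (i : Fin 3) : ‖(n i : ℂ)‖ ≤ freq n := by simpa using abs_le_freq n i
  rw [vertCoef, norm_neg, norm_div]
  have h0 : ‖(n 0 * v n 0 + n 1 * v n 1 : ℂ)‖ ≤ freq n * ‖v n 0‖ + freq n * ‖v n 1‖ := by
    refine (norm_add_le _ _).trans ?_
    rw [norm_mul, norm_mul]
    gcongr
    · exact hn 0
    · exact hn 1
  rcases eq_or_ne (n 2) 0 with h | h
  · rw [h]
    have := freq_nonneg n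
    rw [Int.cast_zero, norm_zero, div_zero]
    positivity
  · refine (div_le_self (norm_nonneg _) ?_).trans h0
    rw [Complex.norm_intCast]
    exact_mod_cast Int.one_le_abs h

theorem summable_vertCoef (h : IsSeriesOf v V) : Summable fun n => ‖vertCoef v n‖ :=
  Summable.of_nonneg_of_le (fun _ => norm_nonneg _) (norm_vertCoef_le v)
    ((h.summable_freq_apply 0).add (h.summable_freq_apply 1))

theorem vertCoef_reflectFreq (h : IsSeriesOf v V) (n : Fin 3 → ℤ) :
    vertCoef v (reflectFreq n) = -vertCoef v n := by
  simp only [vertCoef, h.admissible.reflect, reflectFreq_zero_apply, reflectFreq_one_apply,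
    reflectFreq_two_apply, Int.cast_neg, div_neg]

theorem update_eq_add_single (x : Torus3) (z : UnitAddCircle) :
    Function.update x 2 z = Function.update x 2 0 + Pi.single 2 z := by
  ext j
  rcases eq_or_ne j 2 with rfl | hj
  · simp
  · simp [hj]

/-- The series with coefficients `vertCoef v` has `z`-derivative `-∇_h·V` and is odd in `z`, hence
zero at `z = 0`. By the fundamental theorem of calculus it is the integral defining `vertVel`,
whichever real representative of `z` is used. -/
theorem vertVel_eq (h : IsSeriesOf v V) (x : Torus3) :
    ((vertVel V x : ℝ) : ℂ) = fourierSeries (vertCoef v) x := by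
  have hdsum : Summable fun n => ‖dCoef 2 (vertCoef v) n‖ := by
    simpa only [h.dCoef_vertCoef, norm_neg] using h.summable_divCoef
  set x' := Function.update x 2 0 with hx'
  have hneg (y : Torus3) : fourierSeries (dCoef 2 (vertCoef v)) y = -((divh V y : ℝ) : ℂ) := by
    rw [h.divh_eq, fourierSeries, fourierSeries, ← tsum_neg]
    exact tsum_congr fun n => by rw [h.dCoef_vertCoef]; ring
  have hcont : Continuous fun ζ : ℝ =>
      fourierSeries (dCoef 2 (vertCoef v)) (x' + Pi.single 2 (ζ : UnitAddCircle)) := by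
    refine (continuous_fourierSeries hdsum).comp (continuous_const.add ?_)
    exact (continuous_single 2).comp (AddCircle.continuous_mk' 1)
  set z : ℝ := (AddCircle.equivIco 1 0 (x 2) : ℝ) with hz
  have hzx : (z : UnitAddCircle) = x 2 := AddCircle.coe_equivIco
  have hftc := intervalIntegral.integral_eq_sub_of_hasDerivAt (a := 0) (b := z)
    (fun ζ _ => hasDerivAt_fourierSeries h.summable_vertCoef hdsum x' ζ)
    (hcont.intervalIntegrable _ _)
  have h0 : fourierSeries (vertCoef v) x' = 0 :=
    fourierSeries_eq_zero_of_odd (by simp [hx']) h.vertCoef_reflectFreq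
  rw [hzx, ← update_eq_add_single, Function.update_eq_self, AddCircle.coe_zero, Pi.single_zero,
    add_zero, h0, sub_zero] at hftc
  rw [← hftc, vertVel, Complex.ofReal_neg, ← intervalIntegral.integral_ofReal,
    ← intervalIntegral.integral_neg]
  refine intervalIntegral.integral_congr fun ζ _ => ?_
  simp only [hneg, hx', ← update_eq_add_single]

theorem summable_transport (h : IsSeriesOf v V) (n : Fin 3 → ℤ) (i : Fin 2) :
    HasSum (fun j => transportSymbol j (n - j) (v j) * v (n - j) i)
      (seqConv (fun n => v n 0) (dCoef 0 fun n => v n i) n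
        + seqConv (fun n => v n 1) (dCoef 1 fun n => v n i) n
        + seqConv (vertCoef v) (dCoef 2 fun n => v n i) n) := by
  have hd (j) := summable_dCoef (h.summable_freq_apply i) j
  have h0 := (summable_conv_term (h.summable_apply 0) (hd 0) n).hasSum
  have h1 := (summable_conv_term (h.summable_apply 1) (hd 1) n).hasSum
  have h2 := (summable_conv_term h.summable_vertCoef (hd 2) n).hasSum
  refine ((h0.add h1).add h2).congr_fun fun j => ?_
  simp only [transportSymbol, dCoef, vertCoef]
  ring

theorem summable_transport_vec (h : IsSeriesOf v V) (n : Fin 3 → ℤ) :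
    Summable fun j => transportSymbol j (n - j) (v j) • v (n - j) :=
  Pi.summable.2 fun i => (h.summable_transport n i).summable

theorem transportConv_apply (h : IsSeriesOf v V) (n : Fin 3 → ℤ) (i : Fin 2) :
    transportConv v v n i = seqConv (fun n => v n 0) (dCoef 0 fun n => v n i) n
        + seqConv (fun n => v n 1) (dCoef 1 fun n => v n i) n
        + seqConv (vertCoef v) (dCoef 2 fun n => v n i) n := by
  rw [transportConv, tsum_apply (h.summable_transport_vec n)]
  exact (h.summable_transport n i).tsum_eq

/-- All the series converge absolutely, so products of functions are convolutions of coefficients.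
This turns the equation into a system of ordinary differential equations for the coefficients. -/
theorem coef_Q (h : IsSeriesOf v V) (n : Fin 3 → ℤ) : coef (Q V V) n = transportConv v v n := by
  ext i
  have hd (j) := summable_dCoef (h.summable_freq_apply i) j
  have s0 := summable_seqConv (h.summable_apply 0) (hd 0)
  have s1 := summable_seqConv (h.summable_apply 1) (hd 1)
  have s2 := summable_seqConv h.summable_vertCoef (hd 2)
  have s01 := Summable.of_nonneg_of_le (fun _ => norm_nonneg _) (fun _ => norm_add_le _ _)
    (s0.add s1)
  have s012 := Summable.of_nonneg_of_le (fun _ => norm_nonneg _) (fun _ => norm_add_le _ _)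
    (s01.add s2)
  have hQ : (fun x => ((Q V V x i : ℝ) : ℂ)) = fourierSeries (fun n => transportConv v v n i) := by
    ext x
    rw [Q]
    push_cast
    rw [h.eq_series, h.eq_series, h.vertVel_eq, h.pd_eq, h.pd_eq, h.pd_eq,
      fourierSeries_mul (h.summable_apply 0) (hd 0), fourierSeries_mul (h.summable_apply 1) (hd 1),
      fourierSeries_mul h.summable_vertCoef (hd 2), fourierSeries_add s0 s1,
      fourierSeries_add s01 s2]
    simp only [h.transportConv_apply]
  rw [coef, hQ, mFourierCoeff_fourierSeries]
  simpa only [h.transportConv_apply] using s012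

theorem continuous (h : IsSeriesOf v V) : Continuous V := by
  refine continuous_pi fun i => ?_
  have h1 := Complex.continuous_re.comp (continuous_fourierSeries (h.summable_apply i))
  refine h1.congr fun x => ?_
  rw [Function.comp_apply, ← h.eq_series, Complex.ofReal_re]

theorem isC1 (h : IsSeriesOf v V) : IsC1 V := by
  rw [IsC1, contDiff_pi]
  intro i
  have h1 := Complex.reCLM.contDiff.comp (contDiff_fourierSeries (h.summable_freq_apply i))
  convert! h1 using 1
  ext x
  rw [Function.comp_apply, ← h.eq_series, Complex.reCLM_apply, Complex.ofReal_re]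

theorem integral_eq (V : Field) (i : Fin 2) :
    ((∫ x, V x i ∂torusMeasure : ℝ) : ℂ) = coef V 0 i := by
  rw [coef, mFourierCoeff_eq, neg_zero, UnitAddTorus.mFourier_zero]
  simp only [ContinuousMap.one_apply, one_mul]
  exact integral_ofReal.symm

theorem memH (h : IsSeriesOf v V) : MemH V where
  memLp := by
    obtain ⟨C, hC⟩ := (isCompact_range h.continuous).isBounded.exists_norm_le
    exact MemLp.of_bound h.continuous.aestronglyMeasurable C
      (Filter.Eventually.of_forall fun x => hC _ (mem_range_self x))
  mean_zero i := by
    have := integral_eq V i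
    rw [h.coef_eq, h.admissible.zero, Pi.zero_apply] at this
    exact_mod_cast this
  barotropic_div_free n hn := by
    rw [h.coef_eq, h.coef_eq]
    exact h.admissible.div_free n hn
  even_z := Filter.Eventually.of_forall fun x => funext fun i => by
    have h1 := h.eq_series (reflectZ x) i
    rw [fourierSeries_reflectZ] at h1
    simp only [h.admissible.reflect] at h1
    rw [← h.eq_series] at h1
    exact_mod_cast h1

theorem ext {V' : Field} (h : IsSeriesOf v V) (h' : IsSeriesOf v V') : V = V' := by
  funext x i
  have := (h.eq_series x i).trans (h'.eq_series x i).symm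
  exact_mod_cast this

end IsSeriesOf

theorem exists_isSeriesOf {v : (Fin 3 → ℤ) → Vec} (hv : Admissible v)
    (hs : Summable fun n => freq n * ‖v n‖) : ∃ V, IsSeriesOf v V := by
  refine ⟨fun x i => (fourierSeries (fun n => v n i) x).re, hv, hs, fun x i => ?_⟩
  refine Complex.conj_eq_iff_re.1 ?_
  exact fourierSeries_star x fun n => by rw [hv.neg]; rfl

/-! ### Recovering a field of `H` from its Fourier coefficients. -/

theorem continuous_of_isC1 {V : Field} (h : IsC1 V) : Continuous V := by
  have hq : IsOpenQuotientMap fun (y : Fin 3 → ℝ) (j : Fin 3) => (y j : UnitAddCircle) :=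
    IsOpenQuotientMap.piMap fun _ => QuotientAddGroup.isOpenQuotientMap_mk
  exact hq.isQuotientMap.continuous_iff.2 h.continuous

theorem measurePreserving_reflectZ : MeasurePreserving reflectZ torusMeasure torusMeasure := by
  have h : reflectZ = fun (x : Torus3) (j : Fin 3) =>
      (if j = 2 then (fun y : UnitAddCircle => -y) else id) (x j) := by
    ext x j
    rcases eq_or_ne j 2 with rfl | hj
    · simp [reflectZ]
    · simp [reflectZ, hj]
  rw [h]
  refine measurePreserving_pi _ _ fun j => ?_
  split_ifs
  · exact Measure.measurePreserving_neg _
  · exact MeasurePreserving.id _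

theorem measurable_reflectZ_equiv : MeasurableEmbedding reflectZ := by
  have h : Function.Involutive reflectZ := fun x => by simp [reflectZ]
  exact (MeasurableEquiv.ofInvolutive reflectZ h
    measurePreserving_reflectZ.measurable).measurableEmbedding

theorem MemH.admissible {U : Field} (h : MemH U) : Admissible (coef U) where
  zero := by
    ext i
    rw [← IsSeriesOf.integral_eq, h.mean_zero]; simp
  neg n := by
    ext i
    rw [Pi.star_apply, coef, coef, mFourierCoeff_eq, mFourierCoeff_eq, RCLike.star_def,
      ← integral_conj]
    refine integral_congr_ae (Filter.Eventually.of_forall fun x => ?_)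
    simp only [map_mul, UnitAddTorus.mFourier_neg, Complex.conj_conj, Complex.conj_ofReal]
  reflect n := by
    ext i
    rw [coef, coef, mFourierCoeff_eq, mFourierCoeff_eq,
      ← measurePreserving_reflectZ.integral_comp measurable_reflectZ_equiv]
    refine integral_congr_ae ?_
    filter_upwards [h.even_z] with x hx
    have hneg : -reflectFreq n = reflectFreq (-n) := by
      have := reflectFreq_sub 0 n
      rw [zero_sub] at this
      rw [this]
      ext j; fin_cases j <;> simp
    have hxx : reflectZ (reflectZ x) = x := by simp [reflectZ]
    rw [hx, hneg, mFourier_reflectFreq, hxx]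
  div_free n hn := h.barotropic_div_free n hn

/-- A continuous function with summable coefficients equals its Fourier series at every point.
Equality everywhere, not only almost everywhere, is what makes uniqueness a pointwise statement. -/
theorem IsC1.isSeriesOf {U : Field} (h1 : IsC1 U) (h : MemH U)
    (hs : Summable fun n => freq n * ‖coef U n‖) : IsSeriesOf (coef U) U := by
  refine ⟨h.admissible, hs, fun x i => ?_⟩
  let f : C(Torus3, ℂ) := ⟨fun x => ((U x i : ℝ) : ℂ), by
    exact Complex.continuous_ofReal.comp ((continuous_apply i).comp (continuous_of_isC1 h1))⟩
  have hsum : Summable (UnitAddTorus.mFourierCoeff f) := by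
    refine Summable.of_norm ?_
    refine Summable.of_nonneg_of_le (fun _ => norm_nonneg _)
      (fun n => norm_le_pi_norm (coef U n) i) ?_
    refine summable_norm_of_freq (a := fun n => (‖coef U n‖ : ℂ)) ?_ |>.congr fun n => by simp
    simpa using hs
  exact (UnitAddTorus.hasSum_mFourier_series_apply_of_summable hsum x).tsum_eq.symm

theorem ae_eq_zero_of_mFourierCoeff {f : Torus3 → ℂ} (hf : MemLp f 2 torusMeasure)
    (h : ∀ n, UnitAddTorus.mFourierCoeff f n = 0) : f =ᵐ[torusMeasure] 0 := by
  have hcoe := hf.coeFn_toLp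
  have hzero : (UnitAddTorus.mFourierBasis (d := Fin 3)).repr (hf.toLp f) = 0 := by
    refine lp.ext (funext fun n => ?_)
    refine (UnitAddTorus.mFourierBasis_repr (d := Fin 3) (hf.toLp f) n).trans ?_
    rw [lp.coeFn_zero, Pi.zero_apply, ← h n]
    refine integral_congr_ae ?_
    filter_upwards [hcoe] with x hx
    exact congrArg (UnitAddTorus.mFourier (-n) x * ·) hx
  have h0 : hf.toLp f = 0 := (LinearIsometryEquiv.map_eq_zero_iff _).1 hzero
  rw [h0] at hcoe
  exact hcoe.symm.trans (Lp.coeFn_zero _ _ _)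

theorem ae_eq_of_coef_eq {U V : Field} (hU : MemLp U 2 torusMeasure)
    (hV : MemLp V 2 torusMeasure) (h : coef U = coef V) : U =ᵐ[torusMeasure] V := by
  have key (i : Fin 2) : ∀ᵐ x ∂torusMeasure, U x i = V x i := by
    have hU' : MemLp (fun x => ((U x i : ℝ) : ℂ)) 2 torusMeasure := (hU.eval i).ofReal
    have hV' : MemLp (fun x => ((V x i : ℝ) : ℂ)) 2 torusMeasure := (hV.eval i).ofReal
    have h0 := ae_eq_zero_of_mFourierCoeff (hU'.sub hV') fun n => by
      have hint {g : Torus3 → ℂ} (hg : MemLp g 2 torusMeasure) :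
          Integrable (fun x => UnitAddTorus.mFourier (-n) x * g x) torusMeasure :=
        (hg.integrable (by norm_num)).bdd_mul
          (UnitAddTorus.mFourier (-n)).continuous.aestronglyMeasurable
          (Filter.Eventually.of_forall fun x => (norm_mFourier_apply _ x).le)
      rw [mFourierCoeff_eq]
      simp only [Pi.sub_apply, mul_sub]
      rw [integral_sub (hint hU') (hint hV'), ← mFourierCoeff_eq, ← mFourierCoeff_eq]
      exact sub_eq_zero.2 (congrFun (congrFun h n) i)
    filter_upwards [h0] with x hx
    rw [Pi.sub_apply, Pi.zero_apply, sub_eq_zero] at hx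
    exact_mod_cast hx
  filter_upwards [key 0, key 1] with x h0 h1
  ext i
  fin_cases i
  · exact h0
  · exact h1

/-! ### Gevrey norms in terms of weighted Fourier coefficients -/

theorem weight_sq (σ ρ : ℝ) (n : Fin 3 → ℤ) :
    weight σ ρ n ^ 2 = Real.exp (2 * ρ * freq n) * freq n ^ (2 * σ) := by
  rw [weight, mul_pow, ← Real.exp_nat_mul, ← Real.rpow_natCast, ← Real.rpow_mul (freq_nonneg n),
    mul_comm]
  congr 2 <;> push_cast <;> ring

theorem weight_mono {σ ρ ρ' : ℝ} (h : ρ ≤ ρ') (n : Fin 3 → ℤ) : weight σ ρ n ≤ weight σ ρ' n := by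
  have h0 := Real.rpow_nonneg (freq_nonneg n) σ
  have h1 := freq_nonneg n
  unfold weight
  gcongr

theorem one_le_weight {σ ρ : ℝ} (hσ : 0 ≤ σ) (hρ : 0 ≤ ρ) {n : Fin 3 → ℤ} (hn : n ≠ 0) :
    1 ≤ weight σ ρ n := by
  have h1 := Real.one_le_rpow (one_le_freq hn) hσ
  have h2 := Real.one_le_exp (mul_nonneg hρ (freq_nonneg n))
  unfold weight
  nlinarith

theorem weight_sub (σ ρ δ : ℝ) (n : Fin 3 → ℤ) :
    weight σ (ρ - δ) n = Real.exp (-(δ * freq n)) * weight σ ρ n := by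
  rw [weight, weight, mul_left_comm, ← Real.exp_add]
  congr 2
  ring

theorem weight_add_half_sq (σ ρ : ℝ) {n : Fin 3 → ℤ} (hn : n ≠ 0) :
    weight (σ + 1 / 2) ρ n ^ 2 = freq n * weight σ ρ n ^ 2 := by
  rw [weight_sq, weight_sq, mul_add, Real.rpow_add (freq_pos hn)]
  norm_num
  ring

theorem sum_norm_sq_le (a : Vec) : ∑ i, ‖a i‖ ^ 2 ≤ 2 * ‖a‖ ^ 2 := by
  rw [Fin.sum_univ_two]
  have h0 := pow_le_pow_left₀ (norm_nonneg _) (norm_le_pi_norm a 0) 2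
  have h1 := pow_le_pow_left₀ (norm_nonneg _) (norm_le_pi_norm a 1) 2
  linarith

theorem norm_sq_le_sum (a : Vec) : ‖a‖ ^ 2 ≤ ∑ i, ‖a i‖ ^ 2 := by
  have h (i : Fin 2) : ‖a i‖ ≤ Real.sqrt (∑ i, ‖a i‖ ^ 2) := by
    refine Real.le_sqrt_of_sq_le ?_
    exact Finset.single_le_sum (f := fun i => ‖a i‖ ^ 2) (fun _ _ => by positivity)
      (Finset.mem_univ i)
  have h1 := (pi_norm_le_iff_of_nonneg (Real.sqrt_nonneg _)).2 h
  have h2 := pow_le_pow_left₀ (norm_nonneg _) h1 2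
  rwa [Real.sq_sqrt (by positivity)] at h2

theorem gevreyENorm_sq (σ r : ℝ) (f : Field) :
    gevreyENorm σ r f ^ 2 = ∑' n : Fin 3 → ℤ, ENNReal.ofReal
      ((1 + Real.exp (2 * r * freq n) * freq n ^ (2 * σ)) * ∑ i, ‖coef f n i‖ ^ 2) := by
  rw [gevreyENorm, ← ENNReal.rpow_two, ← ENNReal.rpow_mul]
  norm_num

theorem tsum_weight_le_gevreyENorm (σ r : ℝ) (f : Field) :
    ∑' n, ENNReal.ofReal (weight σ r n * ‖coef f n‖) ^ 2 ≤ gevreyENorm σ r f ^ 2 := by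
  rw [gevreyENorm_sq]
  refine ENNReal.tsum_le_tsum fun n => ?_
  rw [← ENNReal.ofReal_pow (mul_nonneg (weight_nonneg _ _ _) (norm_nonneg _)), mul_pow, ← weight_sq]
  refine ENNReal.ofReal_le_ofReal ?_
  have h1 := norm_sq_le_sum (coef f n)
  have h2 : 0 ≤ ‖coef f n‖ ^ 2 := by positivity
  have h3 : 0 ≤ weight σ r n ^ 2 := by positivity
  nlinarith [mul_le_mul_of_nonneg_left h1 h3]

/-- For nonzero frequencies the weight is at least one, so it dominates the `L²` part of the norm;
the zero mode is absent. One factor `2` comes from this, the other from the two components. -/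
theorem gevrey_term_le {σ ρ : ℝ} (hσ : 0 ≤ σ) (hρ : 0 ≤ ρ) {v : (Fin 3 → ℤ) → Vec}
    (hv : v 0 = 0) (n : Fin 3 → ℤ) :
    (1 + Real.exp (2 * ρ * freq n) * freq n ^ (2 * σ)) * ∑ i, ‖v n i‖ ^ 2
      ≤ 4 * (weight σ ρ n ^ 2 * ‖v n‖ ^ 2) := by
  rcases eq_or_ne n 0 with rfl | hn
  · simp [hv]
  · rw [← weight_sq]
    have h1 := sum_norm_sq_le (v n)
    have h2 : 1 ≤ weight σ ρ n ^ 2 := one_le_pow₀ (one_le_weight hσ hρ hn)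
    have h3 : 0 ≤ ‖v n‖ ^ 2 := by positivity
    calc _ ≤ (weight σ ρ n ^ 2 + weight σ ρ n ^ 2) * (2 * ‖v n‖ ^ 2) := by gcongr
      _ = _ := by ring

/-- Cauchy–Schwarz against `|n|^{1-σ}`, using `|n| ≤ |n|^{1-σ} · weight`. Hence the Gevrey classes
consist of fields with an absolutely convergent gradient series. -/
theorem summable_freq_mul_norm {σ ρ : ℝ} (hσ : 5 / 2 < σ) (hρ : 0 ≤ ρ)
    {v : (Fin 3 → ℤ) → Vec}
    (h : ∑' n, ENNReal.ofReal (weight σ ρ n * ‖v n‖) ^ 2 < ∞) :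
    Summable fun n => freq n * ‖v n‖ := by
  have hfin : ∑' n, ENNReal.ofReal (freq n ^ (1 - σ)) * ENNReal.ofReal (weight σ ρ n * ‖v n‖)
      < ∞ := by
    have := (tsum_mul_sq_le (fun n => ENNReal.ofReal (freq n ^ (1 - σ)))
      (fun n => ENNReal.ofReal (weight σ ρ n * ‖v n‖))).trans_lt
      (ENNReal.mul_lt_top (latticeSum_lt_top hσ) h)
    exact (ENNReal.pow_lt_top_iff.1 this).resolve_right two_ne_zero
  have hs := ENNReal.summable_toReal hfin.ne
  refine Summable.of_nonneg_of_le (fun n => mul_nonneg (freq_nonneg n) (norm_nonneg _))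
    (fun n => ?_) hs
  have h0 := Real.rpow_nonneg (freq_nonneg n) (1 - σ)
  have h1 := weight_nonneg σ ρ n
  rw [ENNReal.toReal_mul, ENNReal.toReal_ofReal h0, ENNReal.toReal_ofReal (by positivity),
    ← mul_assoc]
  gcongr
  rcases eq_or_ne n 0 with rfl | hn
  · rw [freq_zero]; positivity
  · rw [weight, ← mul_assoc, ← Real.rpow_add (freq_pos hn)]
    have := Real.one_le_exp (mul_nonneg hρ (freq_nonneg n))
    norm_num
    exact le_mul_of_one_le_right (freq_nonneg n) this

theorem MemGevrey.summable_freq_mul_norm {σ ρ : ℝ} {f : Field} (h : MemGevrey σ ρ f)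
    (hσ : 5 / 2 < σ) (hρ : 0 ≤ ρ) : Summable fun n => freq n * ‖coef f n‖ :=
  DampedPE.summable_freq_mul_norm hσ hρ ((tsum_weight_le_gevreyENorm σ ρ f).trans_lt
    (ENNReal.pow_lt_top h.2))

/-! ### Curves of fields with a common majorant -/

/-- The curve of fields `U` on `[0, τ]` has continuous coefficients dominated by the
square-summable majorant `A` in the Gevrey space of index `σ` and radius `φ(t) + μ t`. -/
structure IsMajorized (σ μ τ : ℝ) (φ : ℝ → ℝ) (A : (Fin 3 → ℤ) → ℝ) (u : ℝ → (Fin 3 → ℤ) → Vec)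
    (U : ℝ → Field) : Prop where
  series : ∀ t ∈ Icc 0 τ, IsSeriesOf (u t) (U t)
  continuousOn : ∀ n, ContinuousOn (fun t => u t n) (Icc 0 τ)
  bound : ∀ t ∈ Icc 0 τ, ∀ n, weight σ (φ t) n * ‖u t n‖ ≤ Real.exp (-(μ * t * freq n)) * A n
  summable : Summable fun n => A n ^ 2
  nonneg : ∀ n, 0 ≤ A n

namespace IsMajorized

variable {σ μ τ : ℝ} {φ : ℝ → ℝ} {A : (Fin 3 → ℤ) → ℝ} {u : ℝ → (Fin 3 → ℤ) → Vec}
  {U : ℝ → Field}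

theorem weight_mul_norm_le (h : IsMajorized σ μ τ φ A u U) (hμ : 0 ≤ μ) {t : ℝ}
    (ht : t ∈ Icc 0 τ) (n : Fin 3 → ℤ) : weight σ (φ t) n * ‖u t n‖ ≤ A n := by
  refine (h.bound t ht n).trans (mul_le_of_le_one_left (h.nonneg n) ?_)
  rw [Real.exp_le_one_iff]
  have := mul_nonneg (mul_nonneg hμ ht.1) (freq_nonneg n)
  linarith

theorem norm_le (h : IsMajorized σ μ τ φ A u U) (hσ : 0 ≤ σ) (hμ : 0 ≤ μ) {t : ℝ}
    (hφ : 0 ≤ φ t) (ht : t ∈ Icc 0 τ) (n : Fin 3 → ℤ) : ‖u t n‖ ≤ A n := by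
  rcases eq_or_ne n 0 with rfl | hn
  · rw [(h.series t ht).admissible.zero, norm_zero]
    exact h.nonneg 0
  · refine le_trans ?_ (h.weight_mul_norm_le hμ ht n)
    exact le_mul_of_one_le_left (norm_nonneg _) (one_le_weight hσ hφ hn)

theorem memGevrey (h : IsMajorized σ μ τ φ A u U) (hσ : 0 ≤ σ) (hμ : 0 ≤ μ) {t : ℝ}
    (hφ : 0 ≤ φ t) (ht : t ∈ Icc 0 τ) : MemGevrey σ (φ t) (U t) := by
  refine ⟨(h.series t ht).memH.memLp, ?_⟩
  rw [← ENNReal.pow_lt_top_iff (n := 2) |>.trans (or_iff_left two_ne_zero), gevreyENorm_sq,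
    (h.series t ht).coef_eq_fun]
  refine lt_of_le_of_lt (ENNReal.tsum_le_tsum fun n => ENNReal.ofReal_le_ofReal
    ((gevrey_term_le hσ hφ (h.series t ht).admissible.zero n).trans ?_))
    (h.summable.mul_left 4).tsum_ofReal_lt_top
  have := pow_le_pow_left₀ (mul_nonneg (weight_nonneg _ _ _) (norm_nonneg _))
    (h.weight_mul_norm_le hμ ht n) 2
  rw [mul_pow] at this
  linarith

/-- Dominated convergence in the sum over modes: each mode is continuous in time and `16 A²` is a
summable bound (four squares, each at most `(2A)²`). -/
theorem memCGevrey (h : IsMajorized σ μ τ φ A u U) (hσ : 0 ≤ σ) (hμ : 0 ≤ μ)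
    (hφ : ∀ t ∈ Icc 0 τ, 0 ≤ φ t) (hφc : Continuous φ) : MemCGevrey σ φ τ U := by
  refine ⟨fun t ht => h.memGevrey hσ hμ (hφ t ht) ht, fun t₀ ht₀ => ?_⟩
  set F : ℝ → (Fin 3 → ℤ) → ℝ := fun t n =>
    freq n ^ (2 * σ) * ∑ i, ‖(Real.exp (φ t * freq n) : ℂ) * coef (U t) n i
        - (Real.exp (φ t₀ * freq n) : ℂ) * coef (U t₀) n i‖ ^ 2
      + ∑ i, ‖coef (U t) n i - coef (U t₀) n i‖ ^ 2 with hF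
  have hp (n) := Real.rpow_nonneg (freq_nonneg n) (2 * σ)
  have hF0 (t n) : 0 ≤ F t n := by
    have := hp n
    positivity
  have hsq (n : Fin 3 → ℤ) : freq n ^ (2 * σ) = (freq n ^ σ) ^ 2 := by
    rw [← Real.rpow_natCast, ← Real.rpow_mul (freq_nonneg n)]
    congr 1; push_cast; ring
  have hw {t} (ht : t ∈ Icc 0 τ) (n i) :
      freq n ^ σ * ‖(Real.exp (φ t * freq n) : ℂ) * u t n i‖ ≤ A n := by
    refine le_trans ?_ (h.weight_mul_norm_le hμ ht n)
    rw [norm_mul, Complex.norm_real, Real.norm_of_nonneg (Real.exp_nonneg _), ← mul_assoc]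
    exact mul_le_mul_of_nonneg_left (norm_le_pi_norm (u t n) i) (weight_nonneg _ _ _)
  have hFA {t} (ht : t ∈ Icc 0 τ) (n) : F t n ≤ 16 * A n ^ 2 := by
    simp only [hF, (h.series t ht).coef_eq, (h.series t₀ ht₀).coef_eq, Fin.sum_univ_two]
    have h1 (i : Fin 2) : freq n ^ (2 * σ) * ‖(Real.exp (φ t * freq n) : ℂ) * u t n i
        - (Real.exp (φ t₀ * freq n) : ℂ) * u t₀ n i‖ ^ 2 ≤ (A n + A n) ^ 2 := by
      rw [hsq, ← mul_pow]
      have h0 := Real.rpow_nonneg (freq_nonneg n) σ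
      refine pow_le_pow_left₀ (mul_nonneg h0 (norm_nonneg _)) ?_ 2
      refine (mul_le_mul_of_nonneg_left (norm_sub_le _ _) h0).trans ?_
      rw [mul_add]
      exact add_le_add (hw ht n i) (hw ht₀ n i)
    have h2 (i : Fin 2) : ‖u t n i - u t₀ n i‖ ^ 2 ≤ (A n + A n) ^ 2 := by
      refine pow_le_pow_left₀ (norm_nonneg _) ((norm_sub_le _ _).trans (add_le_add ?_ ?_)) 2
      · exact (norm_le_pi_norm (u t n) i).trans (h.norm_le hσ hμ (hφ t ht) ht n)
      · exact (norm_le_pi_norm (u t₀ n) i).trans (h.norm_le hσ hμ (hφ t₀ ht₀) ht₀ n)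
    rw [mul_add]
    linarith [h1 0, h1 1, h2 0, h2 1]
  have hmem := self_mem_nhdsWithin (a := t₀) (s := Icc (0 : ℝ) τ)
  have hlim : Tendsto (fun t => ∑' n, F t n) (𝓝[Icc 0 τ] t₀) (𝓝 (∑' _ : Fin 3 → ℤ, (0 : ℝ))) := by
    refine tendsto_tsum_of_dominated_convergence (bound := fun n => 16 * A n ^ 2)
      (h.summable.mul_left 16) (fun n => ?_) ?_
    · have hu (i : Fin 2) : Tendsto (fun t => coef (U t) n i) (𝓝[Icc 0 τ] t₀)
          (𝓝 (coef (U t₀) n i)) := by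
        have h1 : ContinuousWithinAt (fun t => u t n i) (Icc 0 τ) t₀ :=
          (continuous_apply i).continuousAt.comp_continuousWithinAt (h.continuousOn n t₀ ht₀)
        rw [(h.series t₀ ht₀).coef_eq]
        refine Tendsto.congr' ?_ h1
        filter_upwards [hmem] with t ht
        rw [(h.series t ht).coef_eq]
      have he : Tendsto (fun t => (Real.exp (φ t * freq n) : ℂ)) (𝓝[Icc 0 τ] t₀)
          (𝓝 (Real.exp (φ t₀ * freq n) : ℂ)) := by
        have : Continuous fun t => (Real.exp (φ t * freq n) : ℂ) := by fun_prop
        exact (this.tendsto t₀).mono_left nhdsWithin_le_nhds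
      have hz : F t₀ n = 0 := by simp [hF]
      rw [show 𝓝 (0 : ℝ) = 𝓝 (F t₀ n) by rw [hz]]
      refine Tendsto.add (Tendsto.const_mul _ ?_) ?_
      · exact tendsto_finsetSum _ fun i _ =>
          (((he.mul (hu i)).sub tendsto_const_nhds).norm).pow 2
      · exact tendsto_finsetSum _ fun i _ => (((hu i).sub tendsto_const_nhds).norm).pow 2
    · filter_upwards [hmem] with t ht n
      rw [Real.norm_of_nonneg (hF0 t n)]
      exact hFA ht n
  rw [tsum_zero] at hlim
  have hlim2 := (ENNReal.continuous_ofReal.tendsto 0).comp hlim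
  rw [ENNReal.ofReal_zero] at hlim2
  refine Tendsto.congr' ?_ hlim2
  filter_upwards [hmem] with t ht
  rw [Function.comp_apply, ENNReal.ofReal_tsum_of_nonneg (hF0 t)
    (Summable.of_nonneg_of_le (hF0 t) (hFA ht) (h.summable.mul_left 16))]
  rfl

theorem gevreyENorm_half_sq_le (h : IsMajorized σ μ τ φ A u U) (hσ : 0 ≤ σ) {t : ℝ}
    (hφ : 0 ≤ φ t) (ht : t ∈ Icc 0 τ) :
    gevreyENorm (σ + 1 / 2) (φ t) (U t) ^ 2 ≤ ∑' n, ENNReal.ofReal (4 * A n ^ 2)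
      * ENNReal.ofReal (freq n * Real.exp (-(2 * μ * freq n * t))) := by
  rw [gevreyENorm_sq, (h.series t ht).coef_eq_fun]
  refine ENNReal.tsum_le_tsum fun n => ?_
  rw [← ENNReal.ofReal_mul (by positivity)]
  refine ENNReal.ofReal_le_ofReal
    ((gevrey_term_le (by linarith) hφ (h.series t ht).admissible.zero n).trans ?_)
  rcases eq_or_ne n 0 with rfl | hn
  · simp [(h.series t ht).admissible.zero]
  · rw [weight_add_half_sq _ _ hn]
    have h1 := pow_le_pow_left₀ (mul_nonneg (weight_nonneg _ _ _) (norm_nonneg _))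
      (h.bound t ht n) 2
    rw [mul_pow, mul_pow, ← Real.exp_nat_mul] at h1
    have h2 : ((2 : ℕ) : ℝ) * -(μ * t * freq n) = -(2 * μ * freq n * t) := by push_cast; ring
    rw [h2] at h1
    have h3 := mul_le_mul_of_nonneg_left h1 (freq_nonneg n)
    linarith

/-- The extra half derivative contributes `|n|` to the squared weight, while the spare radius gives
`e^{-2μ|n|t}`. The time integral of their product is at most `1/(2μ)`, uniformly in `n`, so the sum
over modes stays finite. -/
theorem memL2Gevrey (h : IsMajorized σ μ τ φ A u U) (hσ : 0 ≤ σ) (hμ : 0 < μ) (hτ : 0 ≤ τ)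
    (hφ : ∀ t ∈ Icc 0 τ, 0 ≤ φ t) : MemL2Gevrey (σ + 1 / 2) φ τ U := by
  refine ⟨fun n i => ?_, ?_, ?_⟩
  · have h1 : ContinuousOn (fun t => u t n i) (Icc 0 τ) :=
      (continuous_apply i).comp_continuousOn (h.continuousOn n)
    exact (h1.congr fun t ht => (h.series t ht).coef_eq n i).aestronglyMeasurable
      measurableSet_Icc
  · have hne : ∀ᵐ t ∂(volume.restrict (Icc (0 : ℝ) τ)), t ≠ 0 :=
      ae_restrict_of_ae (Measure.ae_ne volume 0)
    filter_upwards [ae_restrict_mem measurableSet_Icc, hne] with t ht ht0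
    have htpos : 0 < t := lt_of_le_of_ne ht.1 (Ne.symm ht0)
    refine ⟨(h.series t ht).memH.memLp, ?_⟩
    rw [← ENNReal.pow_lt_top_iff (n := 2) |>.trans (or_iff_left two_ne_zero)]
    refine (h.gevreyENorm_half_sq_le hσ (hφ t ht) ht).trans_lt ?_
    have hle (n : Fin 3 → ℤ) : freq n * Real.exp (-(2 * μ * freq n * t)) ≤ 1 / (2 * μ * t) := by
      have hx : 2 * μ * freq n * t ≤ Real.exp (2 * μ * freq n * t) := by
        linarith [Real.add_one_le_exp (2 * μ * freq n * t)]
      rw [le_div_iff₀ (by positivity), Real.exp_neg]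
      have he := Real.exp_pos (2 * μ * freq n * t)
      rw [mul_right_comm, ← div_eq_mul_inv, div_le_one he]
      linarith
    refine lt_of_le_of_lt (ENNReal.tsum_le_tsum fun n =>
      mul_le_mul_right (ENNReal.ofReal_le_ofReal (hle n)) _) ?_
    rw [ENNReal.tsum_mul_right]
    exact ENNReal.mul_lt_top (h.summable.mul_left 4).tsum_ofReal_lt_top ENNReal.ofReal_lt_top
  · refine lt_of_le_of_lt (setLIntegral_mono' measurableSet_Icc fun t ht =>
      h.gevreyENorm_half_sq_le hσ (hφ t ht) ht) ?_
    rw [lintegral_tsum fun n => by fun_prop]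
    have hle (n : Fin 3 → ℤ) : ∫⁻ t in Icc 0 τ, ENNReal.ofReal (4 * A n ^ 2)
        * ENNReal.ofReal (freq n * Real.exp (-(2 * μ * freq n * t)))
        ≤ ENNReal.ofReal (4 * A n ^ 2) * ENNReal.ofReal (1 / (2 * μ)) := by
      rw [lintegral_const_mul _ (by fun_prop)]
      gcongr
      rw [← ofReal_integral_eq_lintegral_ofReal]
      · refine ENNReal.ofReal_le_ofReal ?_
        rw [integral_Icc_eq_integral_Ioc, ← intervalIntegral.integral_of_le hτ,
          intervalIntegral.integral_const_mul]
        rcases eq_or_ne n 0 with rfl | hn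
        · rw [freq_zero, zero_mul]; positivity
        · have hf := freq_pos hn
          have h1 := integral_exp_decay_le (k := 2 * μ * freq n) (by positivity) τ
          rw [intervalIntegral.integral_comp_sub_left
            (fun s => Real.exp (-(2 * μ * freq n * s))) τ, sub_self, sub_zero] at h1
          refine (mul_le_mul_of_nonneg_left h1 hf.le).trans_eq ?_
          field_simp
      · exact Continuous.integrableOn_Icc (by fun_prop)
      · exact Filter.Eventually.of_forall fun t =>
          mul_nonneg (freq_nonneg n) (Real.exp_nonneg _)
    refine lt_of_le_of_lt (ENNReal.tsum_le_tsum hle) ?_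
    rw [ENNReal.tsum_mul_right]
    exact ENNReal.mul_lt_top (h.summable.mul_left 4).tsum_ofReal_lt_top ENNReal.ofReal_lt_top

end IsMajorized

/-! ### The damping factor -/

/-- The damping factor `e^{-ν²t/2}`. -/
def damp (ν t : ℝ) : ℝ := Real.exp (-(1 / 2 * ν ^ 2 * t))

theorem damp_pos (ν t : ℝ) : 0 < damp ν t := Real.exp_pos _

theorem damp_le_one (ν : ℝ) {t : ℝ} (ht : 0 ≤ t) : damp ν t ≤ 1 := by
  rw [damp, Real.exp_le_one_iff]
  have : 0 ≤ 1 / 2 * ν ^ 2 * t := by positivity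
  linarith

theorem continuous_damp (ν : ℝ) : Continuous (damp ν) := by unfold damp; fun_prop

theorem hasDerivAt_damp (ν t : ℝ) : HasDerivAt (damp ν) (-(1 / 2 * ν ^ 2) * damp ν t) t := by
  have h1 : HasDerivAt (fun t : ℝ => -(1 / 2 * ν ^ 2) * t) (-(1 / 2 * ν ^ 2)) t := by
    simpa using (hasDerivAt_id t).const_mul (-(1 / 2 * ν ^ 2))
  have h2 := h1.exp
  have e : damp ν = fun t : ℝ => Real.exp (-(1 / 2 * ν ^ 2) * t) := by
    ext s; rw [damp]; congr 1; ring
  rw [e]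
  convert h2 using 1
  ring

theorem hasDerivAt_inv_damp (ν t : ℝ) :
    HasDerivAt (fun t => (damp ν t)⁻¹) ((1 / 2 * ν ^ 2) * (damp ν t)⁻¹) t := by
  have h := (hasDerivAt_damp ν t).fun_inv (damp_pos ν t).ne'
  refine h.congr_deriv ?_
  have := (damp_pos ν t).ne'
  field_simp

/-- The coefficient of the nonlinearity after the damping has been removed. -/
def dampedCoefficient (ν : ℝ) (ω : WienerSpace) (t : ℝ) : ℝ := -(gammaInv ν ω t * damp ν t)

theorem continuous_gammaInv (ν : ℝ) (ω : WienerSpace) : Continuous (gammaInv ν ω) := by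
  have : Continuous fun t : ℝ => ω.1 t.toNNReal := ω.1.continuous.comp continuous_real_toNNReal
  unfold gammaInv W
  fun_prop

theorem continuous_dampedCoefficient (ν : ℝ) (ω : WienerSpace) :
    Continuous (dampedCoefficient ν ω) :=
  ((continuous_gammaInv ν ω).mul (continuous_damp ν)).neg

theorem gammaInv_pos (ν : ℝ) (ω : WienerSpace) (t : ℝ) : 0 < gammaInv ν ω t := Real.exp_pos _

theorem gammaInv_le_sup {ν T : ℝ} {ω : WienerSpace} {t : ℝ} (ht : t ∈ Icc 0 T) :
    gammaInv ν ω t ≤ supGammaInv ν T ω :=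
  le_csSup (isCompact_Icc.image (continuous_gammaInv ν ω)).bddAbove (mem_image_of_mem _ ht)

theorem abs_dampedCoefficient_le {ν T : ℝ} {ω : WienerSpace} {t : ℝ} (ht : t ∈ Icc 0 T) :
    |dampedCoefficient ν ω t| ≤ supGammaInv ν T ω := by
  have h1 := gammaInv_pos ν ω t
  have h2 := damp_pos ν t
  rw [dampedCoefficient, abs_neg, abs_of_pos (by positivity)]
  exact (mul_le_of_le_one_right h1.le (damp_le_one ν ht.1)).trans (gammaInv_le_sup ht)

theorem transportConv_smul (c : ℝ) (u v : (Fin 3 → ℤ) → Vec) (n : Fin 3 → ℤ) :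
    transportConv (c • u) (c • v) n = (c * c) • transportConv u v n := by
  rw [transportConv, transportConv, ← tsum_const_smul'']
  refine tsum_congr fun j => ?_
  rw [Pi.smul_apply, Pi.smul_apply, transportSymbol_smul, ← Complex.real_smul,
    smul_smul_smul_comm, smul_eq_mul]

theorem Admissible.smul {v : (Fin 3 → ℤ) → Vec} (hv : Admissible v) (c : ℝ) :
    Admissible (c • v) where
  zero := by rw [Pi.smul_apply, hv.zero, smul_zero]
  neg n := by rw [Pi.smul_apply, Pi.smul_apply, hv.neg, star_smul, star_trivial c]
  reflect n := by rw [Pi.smul_apply, Pi.smul_apply, hv.reflect]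
  div_free n hn := by
    have := hv.div_free n hn
    simp only [Pi.smul_apply, Complex.real_smul]
    linear_combination (c : ℂ) * this

/-! ### Existence -/

namespace DuhamelData

variable (D : DuhamelData)

theorem weight_mul_norm_phys_le (x : SeqSpace) (t : ℝ) (n : Fin 3 → ℤ) :
    weight D.σ (D.radius t) n * ‖D.phys x t n‖ ≤ ‖x n‖ := by
  rcases eq_or_ne n 0 with rfl | hn
  · rw [weight_zero D.σ_ne_zero, zero_mul]
    exact norm_nonneg _
  · have := mul_le_mul_of_nonneg_left (D.norm_phys_le x t n) (weight_nonneg D.σ (D.radius t) n)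
    rwa [← mul_assoc, weight_mul_invWeight _ _ hn, one_mul] at this

/-- For `n ≠ 0` the mild equation is differentiated. The weights erase the zero mode from the
fixed-point equation, and its equation holds because the nonlinearity has zero mean. -/
theorem hasDerivWithinAt_phys {x x₀ : SeqSpace} (hx : x = x₀ + D.bilin x x)
    {a : (Fin 3 → ℤ) → Vec} (hx₀ : ∀ t, D.phys x₀ t = a) (hadm : ∀ t, Admissible (D.phys x t))
    (n : Fin 3 → ℤ) {t : ℝ} (ht : t ∈ Icc 0 D.τ) :
    HasDerivWithinAt (fun t => D.phys x t n)
      (D.g t • leray n (transportConv (D.phys x t) (D.phys x t) n)) (Icc 0 D.τ) t := by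
  rcases eq_or_ne n 0 with rfl | hn
  · rw [(hadm t).transportConv_zero, map_zero, smul_zero]
    simp only [phys_zero_apply]
    exact hasDerivWithinAt_const _ _ _
  · have hphys : ∀ s ∈ Icc 0 D.τ, D.phys x s n = a n + ∫ r in (0 : ℝ)..s, D.integrand x x n r := by
      intro s hs
      have h1 := D.phys_add_bilin x₀ x s hn
      rw [← hx, hx₀, duhamel, clamp_of_mem hs] at h1
      exact h1
    have h2 : HasDerivAt (fun s => a n + ∫ r in (0 : ℝ)..s, D.integrand x x n r)
        (D.integrand x x n t) t :=
      ((D.continuous_integrand x x n).integral_hasStrictDerivAt 0 t).hasDerivAt.const_add _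
    exact h2.hasDerivWithinAt.congr hphys (hphys t ht)

/-- The fixed point lives at radius `r - rate·t`, while `φ` loses radius twice as fast. The
difference `rate·t` is the spare decay in `IsMajorized`, with `μ = rate`. -/
theorem exists_gevreySolution {ν : ℝ} {ω : WienerSpace} {U₀ : Field} {R : ℝ} {φ : ℝ → ℝ}
    (hg : D.g = dampedCoefficient ν ω) (hU₀ : MemH U₀) (hU₀G : MemGevrey D.σ D.r U₀) (hR : 0 < R)
    (hU₀R : gevreyNorm D.σ D.r U₀ ≤ R) (hsmall : 8 * bilinConst D.σ * D.M * R ≤ D.rate)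
    (hφc : Continuous φ) (hφ0 : ∀ t ∈ Icc 0 D.τ, 0 ≤ φ t)
    (hφ : ∀ t ∈ Icc 0 D.τ, φ t ≤ D.r - 2 * D.rate * t) :
    ∃ U, IsGevreySolution D.σ ν ω φ U₀ D.τ U := by
  have hrate := D.rate_pos
  have hσ : 0 ≤ D.σ := by linarith [D.hσ]
  have hrad (t) : D.radius t ≤ D.r := by
    have := mul_nonneg hrate.le (clamp_mem D.τ_nonneg t).1
    rw [radius]; linarith
  have hadm₀ := hU₀.admissible
  have hA : ∑' n, ENNReal.ofReal (weight D.σ D.r n * ‖coef U₀ n‖) ^ 2 ≤ ENNReal.ofReal R ^ 2 := by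
    refine (tsum_weight_le_gevreyENorm D.σ D.r U₀).trans (pow_le_pow_left' ?_ 2)
    rw [← ENNReal.ofReal_toReal hU₀G.2.ne]
    exact ENNReal.ofReal_le_ofReal hU₀R
  obtain ⟨x₀, hx₀R, hx₀p, -⟩ := D.exists_seq (fun _ => coef U₀)
    (fun n => weight D.σ D.r n * ‖coef U₀ n‖) R (fun _ _ => hadm₀.zero)
    (fun _ => continuousOn_const)
    (fun t _ n => mul_le_mul_of_nonneg_right (weight_mono (hrad t) n) (norm_nonneg _)) hR.le hA
  obtain ⟨x, hx, hadm⟩ := D.exists_fixedPoint hR hx₀R (fun t => by rw [hx₀p]; exact hadm₀) hsmall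
  have hxsum : Summable fun n => ‖x n‖ ^ 2 := by
    simpa using ENNReal.summable_toReal x.tsum_enorm_sq_lt_top.ne
  have hsum (t) : Summable fun n => freq n * ‖(damp ν t • D.phys x t) n‖ := by
    have h1 := summable_freq_mul_norm (ρ := D.radius t) (v := D.phys x t) D.hσ
      (D.zero_le_radius t) (lt_of_le_of_lt (ENNReal.tsum_le_tsum fun n => pow_le_pow_left'
        (by rw [← ofReal_norm]; exact ENNReal.ofReal_le_ofReal (D.weight_mul_norm_phys_le x t n)) 2)
        x.tsum_enorm_sq_lt_top)
    refine (h1.mul_left (damp ν t)).congr fun n => ?_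
    rw [Pi.smul_apply, norm_smul, Real.norm_of_nonneg (damp_pos ν t).le]
    ring
  choose U hU using fun t => exists_isSeriesOf ((hadm t).smul (damp ν t)) (hsum t)
  have hmaj : IsMajorized D.σ D.rate D.τ φ (fun n => ‖x n‖) (fun t => damp ν t • D.phys x t) U := by
    refine ⟨fun t _ => hU t, fun n => ?_, fun t ht n => ?_, hxsum, fun _ => norm_nonneg _⟩
    · exact ((continuous_damp ν).smul (D.continuous_phys x n)).continuousOn
    · have h1 : weight D.σ (φ t) n ≤ Real.exp (-(D.rate * t * freq n))
          * weight D.σ (D.radius t) n := by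
        rw [← weight_sub]
        refine weight_mono ?_ n
        rw [D.radius_of_mem ht]
        linarith [hφ t ht]
      have h2 : ‖(damp ν t • D.phys x t) n‖ ≤ ‖D.phys x t n‖ := by
        rw [Pi.smul_apply, norm_smul, Real.norm_of_nonneg (damp_pos ν t).le]
        exact mul_le_of_le_one_left (norm_nonneg _) (damp_le_one ν ht.1)
      refine (mul_le_mul h1 h2 (norm_nonneg _)
        (mul_nonneg (Real.exp_nonneg _) (weight_nonneg _ _ _))).trans ?_
      rw [mul_assoc]
      exact mul_le_mul_of_nonneg_left (D.weight_mul_norm_phys_le x t n) (Real.exp_nonneg _)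
  refine ⟨U, ⟨fun t _ => (hU t).memH, fun t _ => (hU t).isC1, ?_, fun t ht n i => ?_⟩,
    hmaj.memCGevrey hσ hrate.le hφ0 hφc, hmaj.memL2Gevrey hσ hrate D.τ_nonneg hφ0⟩
  · refine ae_eq_of_coef_eq (hU 0).memH.memLp hU₀.memLp ?_
    rw [(hU 0).coef_eq_fun]
    ext1 n
    have h0 : (0 : ℝ) ∈ Icc 0 D.τ := ⟨le_rfl, D.τ_nonneg⟩
    rcases eq_or_ne n 0 with rfl | hn
    · rw [((hadm 0).smul _).zero, hadm₀.zero]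
    · have h1 := D.phys_add_bilin x₀ x 0 hn
      rw [← hx, hx₀p, duhamel, clamp_of_mem h0, intervalIntegral.integral_same, add_zero] at h1
      rw [Pi.smul_apply, h1]
      simp [damp]
  · have hV := D.hasDerivWithinAt_phys hx hx₀p hadm n ht
    have hd := (hasDerivAt_damp ν t).hasDerivWithinAt (s := Icc 0 D.τ)
    have hprod := (hasDerivWithinAt_pi.1 (hd.fun_smul hV)) i
    simp only [(hU _).coef_eq, (hU t).coef_Q, transportConv_smul]
    refine hprod.congr_deriv ?_
    have hsm : leraySymbol n ((damp ν t * damp ν t)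
        • transportConv (D.phys x t) (D.phys x t) n) = (damp ν t * damp ν t)
        • leraySymbol n (transportConv (D.phys x t) (D.phys x t) n) := by
      rw [← leray_apply, ← leray_apply, ContinuousLinearMap.map_smul_of_tower]
    rw [hsm, hg, leray_apply]
    simp only [Pi.add_apply, Pi.smul_apply, Complex.real_smul, dampedCoefficient]
    push_cast
    ring

end DuhamelData

/-! ### Uniqueness -/

namespace IsGevreySolution

variable {σ ν τ : ℝ} {ω : WienerSpace} {φ : ℝ → ℝ} {U₀ : Field} {U : ℝ → Field}

theorem isSeriesOf (h : IsGevreySolution σ ν ω φ U₀ τ U) (hσ : 5 / 2 < σ) {t : ℝ}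
    (hφ : 0 ≤ φ t) (ht : t ∈ Icc 0 τ) : IsSeriesOf (coef (U t)) (U t) :=
  (h.solves.isC1 t ht).isSeriesOf (h.solves.memH t ht)
    ((h.memC.1 t ht).summable_freq_mul_norm hσ hφ)

theorem weight_mul_norm_le_gevreyNorm {r : ℝ} {f : Field} (h : MemGevrey σ r f)
    (n : Fin 3 → ℤ) : weight σ r n * ‖coef f n‖ ≤ gevreyNorm σ r f := by
  have h1 := (ENNReal.le_tsum
    (f := fun n => ENNReal.ofReal (weight σ r n * ‖coef f n‖) ^ 2) n).trans
    (tsum_weight_le_gevreyENorm σ r f)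
  have h2 := (ENNReal.pow_le_pow_left_iff two_ne_zero).1 h1
  have h3 := ENNReal.toReal_mono h.2.ne h2
  rwa [ENNReal.toReal_ofReal (mul_nonneg (weight_nonneg _ _ _) (norm_nonneg _))] at h3

/-- Continuity bounds the weighted coefficients near each time by one plus the norm at that time;
compactness of `[0, τ]` makes the bound uniform. -/
theorem exists_bound (h : IsGevreySolution σ ν ω φ U₀ τ U) :
    ∃ N, ∀ t ∈ Icc 0 τ, ∀ n, weight σ (φ t) n * ‖coef (U t) n‖ ≤ N := by
  -- The membership is repeated so that the induction over subsets of the interval can use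
  -- neighbourhoods not contained in it.
  suffices H : ∃ N, ∀ t ∈ Icc 0 τ, t ∈ Icc 0 τ → ∀ n, weight σ (φ t) n * ‖coef (U t) n‖ ≤ N by
    obtain ⟨N, hN⟩ := H
    exact ⟨N, fun t ht => hN t ht ht⟩
  refine isCompact_Icc.induction_on
    (p := fun s => ∃ N, ∀ t ∈ s, t ∈ Icc 0 τ → ∀ n, weight σ (φ t) n * ‖coef (U t) n‖ ≤ N)
    ⟨0, fun t ht => ht.elim⟩ ?_ ?_ ?_
  · rintro s s' hss ⟨N, hN⟩
    exact ⟨N, fun t ht => hN t (hss ht)⟩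
  · rintro s s' ⟨N, hN⟩ ⟨N', hN'⟩
    refine ⟨max N N', fun t ht htm n => ?_⟩
    rcases ht with ht | ht
    · exact (hN t ht htm n).trans (le_max_left _ _)
    · exact (hN' t ht htm n).trans (le_max_right _ _)
  · intro t₀ ht₀
    have hev : ∀ᶠ t in 𝓝[Icc 0 τ] t₀, gevreyDistSq σ (φ t) (φ t₀) (U t) (U t₀) < 1 :=
      (h.memC.2 t₀ ht₀).eventually (gt_mem_nhds one_pos)
    refine ⟨{t | gevreyDistSq σ (φ t) (φ t₀) (U t) (U t₀) < 1}, hev,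
      1 + gevreyNorm σ (φ t₀) (U t₀), fun t ht _ n => ?_⟩
    have h1 := (ENNReal.le_tsum n).trans_lt (show _ < (1 : ℝ≥0∞) from ht)
    rw [ENNReal.ofReal_lt_one] at h1
    have hw₀ := weight_mul_norm_le_gevreyNorm (h.memC.1 t₀ ht₀) n
    have hf0 := Real.rpow_nonneg (freq_nonneg n) σ
    have hsq : freq n ^ (2 * σ) = (freq n ^ σ) ^ 2 := by
      rw [← Real.rpow_natCast, ← Real.rpow_mul (freq_nonneg n)]
      congr 1; push_cast; ring
    have hi (i : Fin 2) : weight σ (φ t) n * ‖coef (U t) n i‖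
        ≤ 1 + gevreyNorm σ (φ t₀) (U t₀) := by
      set a := (Real.exp (φ t * freq n) : ℂ) * coef (U t) n i with ha
      set b := (Real.exp (φ t₀ * freq n) : ℂ) * coef (U t₀) n i with hb
      have hda : freq n ^ σ * ‖a - b‖ ≤ 1 := by
        have h2 : ‖a - b‖ ^ 2 ≤ ∑ i, ‖(Real.exp (φ t * freq n) : ℂ) * coef (U t) n i
            - (Real.exp (φ t₀ * freq n) : ℂ) * coef (U t₀) n i‖ ^ 2 :=
          Finset.single_le_sum (f := fun i => ‖(Real.exp (φ t * freq n) : ℂ) * coef (U t) n i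
            - (Real.exp (φ t₀ * freq n) : ℂ) * coef (U t₀) n i‖ ^ 2)
            (fun _ _ => by positivity) (Finset.mem_univ i)
        have h3 : 0 ≤ ∑ i, ‖coef (U t) n i - coef (U t₀) n i‖ ^ 2 := by positivity
        have h4 := mul_le_mul_of_nonneg_left h2 (Real.rpow_nonneg (freq_nonneg n) (2 * σ))
        have h5 : (freq n ^ σ * ‖a - b‖) ^ 2 ≤ 1 := by
          rw [mul_pow, ← hsq]; linarith
        exact (sq_le_one_iff₀ (by positivity)).1 h5
      have hna : weight σ (φ t) n * ‖coef (U t) n i‖ = freq n ^ σ * ‖a‖ := by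
        rw [ha, norm_mul, Complex.norm_real, Real.norm_of_nonneg (Real.exp_nonneg _), weight,
          mul_assoc]
      have hnb : freq n ^ σ * ‖b‖ ≤ gevreyNorm σ (φ t₀) (U t₀) := by
        refine le_trans ?_ hw₀
        rw [hb, norm_mul, Complex.norm_real, Real.norm_of_nonneg (Real.exp_nonneg _), weight,
          mul_assoc]
        gcongr
        exact norm_le_pi_norm (coef (U t₀) n) i
      rw [hna]
      have h6 : ‖a‖ ≤ ‖a - b‖ + ‖b‖ := by
        simpa using norm_add_le (a - b) b
      nlinarith [mul_le_mul_of_nonneg_left h6 hf0]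
    obtain ⟨i, hmax⟩ : ∃ i, ‖coef (U t) n‖ = ‖coef (U t) n i‖ := by
      obtain ⟨i, hi⟩ := Finite.exists_max fun i => ‖coef (U t) n i‖
      exact ⟨i, le_antisymm ((pi_norm_le_iff_of_nonneg (norm_nonneg _)).2 hi)
        (norm_le_pi_norm _ i)⟩
    rw [hmax]
    exact hi i

theorem hasDerivWithinAt_undamped (h : IsGevreySolution σ ν ω φ U₀ τ U) (hσ : 5 / 2 < σ)
    (hφ : ∀ t ∈ Icc 0 τ, 0 ≤ φ t) {t : ℝ} (ht : t ∈ Icc 0 τ) (n : Fin 3 → ℤ) :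
    HasDerivWithinAt (fun t => ((damp ν t)⁻¹ • coef (U t)) n)
      (dampedCoefficient ν ω t • leray n (transportConv ((damp ν t)⁻¹ • coef (U t))
        ((damp ν t)⁻¹ • coef (U t)) n)) (Icc 0 τ) t := by
  have hU : HasDerivWithinAt (fun t => coef (U t) n)
      (fun i => -(gammaInv ν ω t : ℂ) * leraySymbol n (coef (Q (U t) (U t)) n) i
        - (1 / 2 : ℂ) * (ν : ℂ) ^ 2 * coef (U t) n i) (Icc 0 τ) t :=
    hasDerivWithinAt_pi.2 (h.solves.equation t ht n)
  have hd := (hasDerivAt_inv_damp ν t).hasDerivWithinAt (s := Icc 0 τ)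
  refine (hd.fun_smul hU).congr_deriv ?_
  rw [(h.isSeriesOf hσ (hφ t ht) ht).coef_Q, transportConv_smul,
    ContinuousLinearMap.map_smul_of_tower, leray_apply]
  ext i
  have hne : (damp ν t : ℂ) ≠ 0 := by exact_mod_cast (damp_pos ν t).ne'
  simp only [Pi.add_apply, Pi.smul_apply, Complex.real_smul, dampedCoefficient]
  push_cast
  field_simp
  ring

/-- A bound uniform in time at each mode is not yet square summable. Passing from radius `2r` to `r`
provides `e^{-r|n|} ≤ 2/(r²|n|²)`, and `∑ |n|^{-4}` converges in dimension three. -/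
theorem exists_majorant (h : IsGevreySolution σ ν ω φ U₀ τ U) {r : ℝ} (hr : 0 < r)
    (hφ : ∀ t ∈ Icc 0 τ, 2 * r ≤ φ t) :
    ∃ N, 0 ≤ N ∧ ∀ t ∈ Icc 0 τ, ∀ n,
      weight σ r n * ‖((damp ν t)⁻¹ • coef (U t)) n‖ ≤ N * freq n ^ (-2 : ℝ) := by
  obtain ⟨N, hN⟩ := h.exists_bound
  refine ⟨(damp ν τ)⁻¹ * max N 0 * (2 / r ^ 2), ?_, fun t ht n => ?_⟩
  · have := damp_pos ν τ
    have := le_max_right N 0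
    positivity
  rcases eq_or_ne n 0 with rfl | hn
  · rw [Pi.smul_apply, (h.solves.memH t ht).admissible.zero, smul_zero, norm_zero, mul_zero,
      freq_zero, Real.zero_rpow (by norm_num), mul_zero]
  have hf := freq_pos hn
  have hN0 : 0 ≤ max N 0 := le_max_right _ _
  have hd0 := damp_pos ν τ
  have hd : (damp ν t)⁻¹ ≤ (damp ν τ)⁻¹ := by
    refine inv_anti₀ hd0 ?_
    rw [damp, damp]
    gcongr
    exact ht.2
  have hdt := damp_pos ν t
  have hw : weight σ r n ≤ Real.exp (-(r * freq n)) * weight σ (φ t) n := by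
    rw [← weight_sub]
    exact weight_mono (by linarith [hφ t ht]) n
  have he : Real.exp (-(r * freq n)) ≤ 2 / r ^ 2 * freq n ^ (-2 : ℝ) := by
    have hq := Real.quadratic_le_exp_of_nonneg (mul_nonneg hr.le hf.le)
    have hpos : 0 < r * freq n := by positivity
    rw [Real.rpow_neg hf.le, Real.rpow_two, Real.exp_neg, ← div_eq_mul_inv, div_div, ← mul_pow,
      inv_le_comm₀ (Real.exp_pos _) (by positivity), inv_div]
    linarith
  rw [Pi.smul_apply, norm_smul, Real.norm_of_nonneg (inv_nonneg.2 hdt.le)]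
  calc _ ≤ (Real.exp (-(r * freq n)) * weight σ (φ t) n)
        * ((damp ν τ)⁻¹ * ‖coef (U t) n‖) := by
        gcongr
        exact mul_nonneg (Real.exp_nonneg _) (weight_nonneg _ _ _)
    _ = (damp ν τ)⁻¹ * (weight σ (φ t) n * ‖coef (U t) n‖) * Real.exp (-(r * freq n)) := by ring
    _ ≤ (damp ν τ)⁻¹ * max N 0 * (2 / r ^ 2 * freq n ^ (-2 : ℝ)) := by
        gcongr
        exact (hN t ht n).trans (le_max_left _ _)
    _ = _ := by ring

/-- The majorant at radius `r` holds on all of `[0, τ]`, so the comparison argument can be restarted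
from the same radius on every short interval; the solutions themselves need not lose radius. -/
theorem unique {U' : ℝ → Field} (h : IsGevreySolution σ ν ω φ U₀ τ U)
    (h' : IsGevreySolution σ ν ω φ U₀ τ U') (hσ : 5 / 2 < σ) (hτ : 0 < τ) {r : ℝ} (hr : 0 < r)
    (hφ : ∀ t ∈ Icc 0 τ, 2 * r ≤ φ t) : ∀ t ∈ Icc 0 τ, U' t = U t := by
  have hφ0 : ∀ t ∈ Icc 0 τ, 0 ≤ φ t := fun t ht => by linarith [hφ t ht]
  obtain ⟨N, hN0, hN⟩ := h.exists_majorant hr hφ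
  obtain ⟨N', hN0', hN'⟩ := h'.exists_majorant hr hφ
  set v : ℝ → (Fin 3 → ℤ) → Vec := fun t => (damp ν t)⁻¹ • coef (U t) with hv
  set w : ℝ → (Fin 3 → ℤ) → Vec := fun t => (damp ν t)⁻¹ • coef (U' t) with hw
  set A : (Fin 3 → ℤ) → ℝ := fun n => (N + N') * freq n ^ (-2 : ℝ) with hA
  set M := supGammaInv ν τ ω with hM
  have hM0 : 0 ≤ M := (gammaInv_pos ν ω 0).le.trans (gammaInv_le_sup ⟨le_rfl, hτ.le⟩)
  have hAsum : Summable fun n => A n ^ 2 := by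
    refine ((summable_freq_rpow (s := -4) (by norm_num)).mul_left ((N + N') ^ 2)).congr fun n => ?_
    rw [hA, mul_pow, ← Real.rpow_natCast (freq n ^ (-2 : ℝ)), ← Real.rpow_mul (freq_nonneg n)]
    norm_num
  set C := Real.sqrt (∑' n, A n ^ 2) with hC
  have hAC : ∑' n, ENNReal.ofReal (A n) ^ 2 ≤ ENNReal.ofReal C ^ 2 := by
    rw [← ENNReal.ofReal_pow (Real.sqrt_nonneg _), Real.sq_sqrt (tsum_nonneg fun _ => sq_nonneg _),
      ENNReal.ofReal_tsum_of_nonneg (fun _ => sq_nonneg _) hAsum]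
    refine ENNReal.tsum_le_tsum fun n => ?_
    rw [ENNReal.ofReal_pow]
    have := Real.rpow_nonneg (freq_nonneg n) (-2)
    positivity
  -- The smallest natural rate that makes `eq_of_mild` applicable; the `+ 1` gives both strictness
  -- and positivity.
  set rate := 2 * bilinConst σ * M * C + 1 with hrate
  have hK := bilinConst_nonneg σ
  have hrate0 : 0 < rate := by positivity
  -- Enough steps that the radius used up on one of them, `rate * δ`, is at most `r`.
  obtain ⟨m, hm⟩ := exists_nat_gt (rate * τ / r)
  have hm0 : (0 : ℝ) < m := lt_of_le_of_lt (by positivity) hm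
  set δ := τ / m with hδ
  have hδ0 : 0 < δ := by positivity
  have hmδ : m * δ = τ := by rw [hδ]; field_simp
  have hδr : rate * δ ≤ r := by
    rw [div_lt_iff₀ hr] at hm
    rw [hδ, mul_div_assoc', div_le_iff₀ hm0]
    linarith
  have hstep : ∀ i : ℕ, i ≤ m → ∀ t ∈ Icc 0 (i * δ), v t = w t := by
    intro i
    induction i with
    | zero =>
      intro _ t ht
      have ht0 : t = 0 := by
        have := ht.1
        have := ht.2
        rw [Nat.cast_zero, zero_mul] at this
        linarith
      have hco : coef (U 0) = coef (U' 0) := by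
        funext n i
        refine integral_congr_ae ?_
        filter_upwards [h.solves.init.trans h'.solves.init.symm] with x hx
        rw [hx]
      rw [ht0, hv, hw]
      simp only [hco]
    | succ i ih =>
      intro him t ht
      have ih' := ih (Nat.le_of_succ_le him)
      rcases le_total t (i * δ) with hti | hti
      · exact ih' t ⟨ht.1, hti⟩
      have hi0 : 0 ≤ i * δ := by positivity
      have him' : ((i : ℝ) + 1) * δ ≤ τ := by
        rw [← hmδ]
        gcongr
        exact_mod_cast him
      have hshift {s : ℝ} (hs : s ∈ Icc 0 δ) : i * δ + s ∈ Icc 0 τ :=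
        ⟨by linarith [hs.1], by linarith [hs.2]⟩
      let D : DuhamelData :=
        { σ := σ, r := r, rate := rate, τ := δ, M := M
          g := fun s => dampedCoefficient ν ω (i * δ + s)
          hσ := hσ
          rate_pos := hrate0
          τ_nonneg := hδ0.le
          radius_nonneg := hδr
          M_nonneg := hM0
          continuous_g := (continuous_dampedCoefficient ν ω).comp (by fun_prop)
          abs_g_le := fun s hs => abs_dampedCoefficient_le (hshift hs) }
      have hderiv {z : ℝ → (Fin 3 → ℤ) → Vec} (hz : ∀ t ∈ Icc 0 τ, ∀ n,
          HasDerivWithinAt (fun t => z t n)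
            (dampedCoefficient ν ω t • leray n (transportConv (z t) (z t) n)) (Icc 0 τ) t) :
          ∀ s ∈ Icc 0 D.τ, ∀ n, HasDerivWithinAt (fun s => z (i * δ + s) n)
            (D.g s • leray n (transportConv (z (i * δ + s)) (z (i * δ + s)) n)) (Icc 0 D.τ) s := by
        intro s hs n
        have h1 := (hz _ (hshift hs) n).scomp (t' := Icc 0 τ) (h := fun s => i * δ + s) s
          (((hasDerivAt_id s).const_add (i * δ)).hasDerivWithinAt (s := Icc 0 D.τ))
          (fun s hs => hshift hs)
        rw [one_smul] at h1
        exact h1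
      have hrad (s : ℝ) : D.radius s ≤ r := by
        have := mul_nonneg hrate0.le (clamp_mem hδ0.le s).1
        change r - rate * clamp δ s ≤ r
        linarith
      have hbd {z : ℝ → (Fin 3 → ℤ) → Vec} (hz : ∀ t ∈ Icc 0 τ, ∀ n,
          weight σ r n * ‖z t n‖ ≤ A n) : ∀ s ∈ Icc 0 D.τ, ∀ n,
          weight D.σ (D.radius s) n * ‖z (i * δ + s) n‖ ≤ A n := fun s hs n =>
        (mul_le_mul_of_nonneg_right (weight_mono (hrad s) n) (norm_nonneg _)).trans
          (hz _ (hshift hs) n)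
      have hvd := hderiv fun t ht n => h.hasDerivWithinAt_undamped hσ hφ0 ht n
      have hwd := hderiv fun t ht n => h'.hasDerivWithinAt_undamped hσ hφ0 ht n
      have hadm {t} (ht : t ∈ Icc 0 τ) : Admissible (v t) :=
        (h.solves.memH t ht).admissible.smul _
      have hadm' {t} (ht : t ∈ Icc 0 τ) : Admissible (w t) :=
        (h'.solves.memH t ht).admissible.smul _
      have hf (n) : 0 ≤ freq n ^ (-2 : ℝ) := Real.rpow_nonneg (freq_nonneg n) _
      have heq := D.eq_of_mild (v := fun s => v (i * δ + s)) (w := fun s => w (i * δ + s))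
        (A := A) (C := C) (fun s hs => (hadm (hshift hs)).zero)
        (fun s hs => (hadm' (hshift hs)).zero)
        (fun n s hs => (hvd s hs n).continuousWithinAt)
        (fun n s hs => (hwd s hs n).continuousWithinAt)
        (hbd fun t ht n => (hN t ht n).trans (by rw [hA]; nlinarith [mul_nonneg hN0' (hf n)]))
        (hbd fun t ht n => (hN' t ht n).trans (by rw [hA]; nlinarith [mul_nonneg hN0 (hf n)]))
        (Real.sqrt_nonneg _) hAC
        (fun n => by
          simp only [add_zero]
          rw [ih' (i * δ) ⟨hi0, le_rfl⟩])
        hvd hwd (by change 2 * bilinConst σ * M * C < rate; linarith)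
      have hlast := heq (t - i * δ) ⟨by linarith, by
        have := ht.2
        push_cast at this
        change t - i * δ ≤ δ
        linarith⟩
      simpa using hlast
  intro t ht
  have hvw : v t = w t := hstep m le_rfl t (by rwa [hmδ])
  have hco : coef (U t) = coef (U' t) := by
    have hne := inv_ne_zero (damp_pos ν t).ne'
    exact smul_right_injective _ hne hvw
  have h1 := h.isSeriesOf hσ (hφ0 t ht) ht
  have h2 := h'.isSeriesOf hσ (hφ0 t ht) ht
  rw [← hco] at h2
  exact h2.ext h1

end IsGevreySolution

/-! ### The radius of analyticity and the existence time -/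

/-- The rate at which the radius of analyticity has to shrink. -/
def shrinkRate (σ R M : ℝ) : ℝ := 8 * bilinConst σ * M * (R + 1) + 1

/-- The existence time. -/
def existenceTime (σ T R φ₀ M : ℝ) : ℝ := min T (φ₀ / (4 * shrinkRate σ R M))

/-- From `e^y ≥ 1 + y` and `(1 + y)(1 - y/2) ≥ 1` on `[0,1]`. It compares the exponentially
decreasing `φ` with a linearly shrinking radius. -/
theorem exp_neg_le_one_sub_half {y : ℝ} (h0 : 0 ≤ y) (h1 : y ≤ 1) :
    Real.exp (-y) ≤ 1 - y / 2 := by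
  have h := Real.add_one_le_exp y
  rw [Real.exp_neg, inv_le_comm₀ (Real.exp_pos _) (by linarith),
    inv_le_iff_one_le_mul₀ (by linarith)]
  nlinarith

end DampedPE

end

/-! ### Choice of the radius and of the time, and conclusion. -/

theorem proposition4p1 (σ : ℝ) (hσ : 5 / 2 < σ) (T : ℝ) (hT : 0 < T) :
    ∃ 𝒯 : ℝ → ℝ → ℝ → ℝ,
      ∀ (ν : ℝ), 0 < ν → ∀ (φ₀ : ℝ), 0 < φ₀ →
      ∀ (U₀ : DampedPE.Field), DampedPE.MemH U₀ → DampedPE.MemGevrey σ φ₀ U₀ →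
      ∀ (ω : DampedPE.WienerSpace),
        ∃ (φ : ℝ → ℝ) (τ : ℝ),
          τ = 𝒯 (DampedPE.gevreyNorm σ φ₀ U₀) φ₀ (DampedPE.supGammaInv ν T ω) ∧
          0 < τ ∧ τ ≤ T ∧
          ContDiff ℝ 1 φ ∧ φ 0 = φ₀ ∧
          (∀ t ∈ Set.Icc (0 : ℝ) T, 0 < φ t ∧ deriv φ t ≤ 0) ∧
          ∃ U : ℝ → DampedPE.Field,
            DampedPE.IsGevreySolution σ ν ω φ U₀ τ U ∧
            ∀ U' : ℝ → DampedPE.Field, DampedPE.IsGevreySolution σ ν ω φ U₀ τ U' →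
              ∀ t ∈ Set.Icc (0 : ℝ) τ, U' t = U t := by
  refine ⟨DampedPE.existenceTime σ T, fun ν _ φ₀ hφ₀ U₀ hU₀ hU₀G ω => ?_⟩
  set R := DampedPE.gevreyNorm σ φ₀ U₀ with hR
  set M := DampedPE.supGammaInv ν T ω with hM
  set rate := DampedPE.shrinkRate σ R M with hrate
  -- With this `c`, `φ₀ (1 - ct/2) = φ₀ - 2 rate t`, and the time bound `φ₀/(4 rate)` is exactly `ct
  -- ≤ 1`. The exponential keeps `φ` positive and decreasing on the whole of `[0, T]`, beyond the
  -- existence time.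
  set c := 4 * rate / φ₀ with hc
  have hR0 : 0 ≤ R := ENNReal.toReal_nonneg
  have hM0 : 0 ≤ M :=
    (DampedPE.gammaInv_pos ν ω 0).le.trans (DampedPE.gammaInv_le_sup ⟨le_rfl, hT.le⟩)
  have hK := DampedPE.bilinConst_nonneg σ
  have hrate0 : 0 < rate := by rw [hrate, DampedPE.shrinkRate]; positivity
  have hc0 : 0 < c := by positivity
  set τ := DampedPE.existenceTime σ T R φ₀ M with hτ
  have hτ0 : 0 < τ := lt_min hT (by positivity)
  have hτT : τ ≤ T := min_le_left _ _
  have hτr : τ * (4 * rate) ≤ φ₀ := (le_div_iff₀ (by positivity)).1 (min_le_right _ _)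
  have hderiv (t : ℝ) : HasDerivAt (fun t => φ₀ * Real.exp (-(c * t)))
      (φ₀ * (Real.exp (-(c * t)) * -c)) t := by
    have h1 : HasDerivAt (fun t : ℝ => -(c * t)) (-c) t := by
      simpa using ((hasDerivAt_id t).const_mul c).fun_neg
    exact h1.exp.const_mul φ₀
  refine ⟨fun t => φ₀ * Real.exp (-(c * t)), τ, rfl, hτ0, hτT, by fun_prop, by simp,
    fun t _ => ⟨by positivity, ?_⟩, ?_⟩
  · rw [(hderiv t).deriv]
    have : 0 ≤ φ₀ * (Real.exp (-(c * t)) * c) := by positivity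
    linarith
  have hle : ∀ t ∈ Set.Icc 0 τ, φ₀ * Real.exp (-(c * t)) ≤ φ₀ - 2 * rate * t := by
    intro t ht
    have hct : c * t * φ₀ = 4 * rate * t := by rw [hc]; field_simp
    have h1 : c * t ≤ 1 := by
      refine le_of_mul_le_mul_right ?_ hφ₀
      rw [hct, one_mul]
      refine le_trans ?_ hτr
      rw [mul_comm τ]
      exact mul_le_mul_of_nonneg_left ht.2 (by positivity)
    have h2 := DampedPE.exp_neg_le_one_sub_half (mul_nonneg hc0.le ht.1) h1
    have h3 := mul_le_mul_of_nonneg_left h2 hφ₀.le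
    linarith
  let D : DampedPE.DuhamelData :=
    { σ := σ, r := φ₀, rate := rate, τ := τ, M := M
      g := DampedPE.dampedCoefficient ν ω
      hσ := hσ
      rate_pos := hrate0
      τ_nonneg := hτ0.le
      radius_nonneg := by nlinarith
      M_nonneg := hM0
      continuous_g := DampedPE.continuous_dampedCoefficient ν ω
      abs_g_le := fun t ht => DampedPE.abs_dampedCoefficient_le ⟨ht.1, ht.2.trans hτT⟩ }
  -- `R + 1` in place of `R` keeps the ball radius positive when the initial datum is zero.
  obtain ⟨U, hU⟩ := D.exists_gevreySolution (ν := ν) (ω := ω) (U₀ := U₀) (R := R + 1)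
    (φ := fun t => φ₀ * Real.exp (-(c * t))) rfl hU₀ hU₀G (by linarith)
    (by change R ≤ R + 1; linarith)
    (by
      change 8 * DampedPE.bilinConst σ * M * (R + 1) ≤ rate
      rw [hrate, DampedPE.shrinkRate]
      linarith)
    (by fun_prop) (fun t _ => by positivity) hle
  refine ⟨U, hU, fun U' hU' => ?_⟩
  -- As `φ` decreases, its minimum on `[0, τ]` is `φ(τ)`, which is set equal to `2r`.
  refine DampedPE.IsGevreySolution.unique hU hU' hσ hτ0
    (r := φ₀ * Real.exp (-(c * τ)) / 2) (by positivity) fun t ht => ?_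
  rw [mul_div_cancel₀ _ two_ne_zero]
  have := ht.2
  gcongr
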